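/- Let $k$ be an arbitrary field and let $Q$ be a finite quiver with vertex set $Q_0$ and arrow set $Q_1$. Let $kQ^c$ be the path coalgebra of $Q$: it has as $k$-basis all paths of $Q$ (including the trivial paths $e_i$, $i\in Q_0$), with $\Delta(p)=\sum_{p=qr}q\otimes r$ (sum over all splittings of $p$ as a concatenation of two paths), $\varepsilon(e_i)=1$, and $\varepsilon(p)=0$ for every nontrivial path $p$. For $n\ge 1$ let $kQ^c_{\le n}\subseteq kQ^c$ be the subcoalgebra spanned by the paths of length at most $n$. For $s,t\in Q_0$ let $(Q_1)_{s,t}$ be the set of arrows from $s$ to $t$, let $P_{s,t}$ be the set of nontrivial paths from $s$ to $t$, let $(P_{\le n})_{s,t}$ be the set of paths $p$ from $s$ to $t$ of length $1\le l(p)\le n$, and let $(Q_1^\tau)_{s,t}$ be the set of arrows from $s$ to $t$ in the augmented quiver $Q^\tau$, which is obtained from $Q$ by adding one new arrow $s\to t$ for every pair of distinct vertices $s\neq t$. For a coalgebra $C$ over $k$, view $\mathrm{Aut}(C)$ as the group functor $R\mapsto \mathrm{Aut}_{R\text{-coalg}}(R\otimes_k C)$ on commutative $k$-algebras. A linear algebraic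 group over $k$ is a group functor represented by a finitely generated commutative $k$-algebra (its coordinate ring), and its dimension is the Krull dimension of that algebra. Then, for every $n\ge 1$, $\mathrm{Aut}(kQ^c_{\le n})$ is a linear algebraic group over $k$, of dimension \[\dim \mathrm{Aut}(kQ^c_{\le n})=\sum_{s,t\in Q_0}|(Q_1^\tau)_{s,t}|\cdot|(P_{\le n})_{s,t}|.\] If moreover $Q$ is acyclic (has no oriented cycles), then $\mathrm{Aut}(kQ^c)$ is a linear algebraic group over $k$, of dimension \[\dim \mathrm{Aut}(kQ^c)=\sum_{s,t\in Q_0}\bigl(|(Q_1)_{s,t}|+1\bigr)\cdot|P_{s,t}|.\] -/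

import Mathlib

open CategoryTheory TensorProduct

universe u v w

noncomputable section

/-! ## Quivers

A quiver with vertex type `V` is Mathlib's `Quiver V`; `s ⟶ t` is the type of arrows from `s` to
`t`, and `Quiver.Path s t` is the type of all paths (including the trivial one when `s = t`) from
`s` to `t`. -/

/-- The vertices of the augmented quiver are those of the quiver. -/
def AugmentedQuiver (V : Type v) : Type v := V

/-- A vertex of the quiver as a vertex of the augmented quiver. -/
def AugmentedQuiver.of {V : Type v} (s : V) : AugmentedQuiver V := s

/-- The augmented quiver: one new arrow `s ⟶ t` is added for every pair `s ≠ t`. -/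
instance AugmentedQuiver.instQuiver (V : Type v) [Quiver.{w} V] :
    Quiver.{w} (AugmentedQuiver V) where
  Hom s t := (@Quiver.Hom V _ s t) ⊕ PLift (s ≠ t)

/-- A quiver is acyclic if it has no oriented cycle, i.e. the only path from a vertex to itself is
the trivial one. -/
def QuiverAcyclic (V : Type v) [Quiver.{w} V] : Prop :=
  ∀ (s : V) (p : Quiver.Path s s), p.length = 0

/-- The set `P_{s,t}` of nontrivial paths from `s` to `t`. -/
abbrev NontrivialPath {V : Type v} [Quiver.{w} V] (s t : V) : Type (max v w) :=
  {p : Quiver.Path s t // 1 ≤ p.length}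

/-- The set `(P_{≤ n})_{s,t}` of paths `p` from `s` to `t` with `1 ≤ l(p) ≤ n`. -/
abbrev NontrivialPathLE {V : Type v} [Quiver.{w} V] (n : ℕ) (s t : V) : Type (max v w) :=
  {p : Quiver.Path s t // 1 ≤ p.length ∧ p.length ≤ n}

/-! ## Path coalgebras and their truncations -/

/-- The paths of length at most `N` (with arbitrary end points); for `N = ⊤` these are all paths. -/
structure PathUpTo (V : Type v) [Quiver.{w} V] (N : ℕ∞) : Type (max v w) where
  /-- the starting vertex -/
  src : V
  /-- the terminating vertex -/
  tgt : V
  /-- the path -/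
  path : Quiver.Path src tgt
  length_le : (path.length : ℕ∞) ≤ N

/-- The vector space with basis the paths of length at most `N`. For `N = ⊤` this is the path
coalgebra `kQ^c`, and for `N = n` finite it is the truncated path coalgebra `kQ^c_{≤ n}`. -/
def PathCoalgebra (k : Type u) [Field k] (V : Type v) [Quiver.{w} V] (N : ℕ∞) :
    Type (max u v w) :=
  PathUpTo V N →₀ k

namespace PathCoalgebra

section

variable {V : Type v} [Quiver.{w} V]

/-- All the splittings `p = q r` of a path `p = α₁ ⋯ αₙ` as a concatenation of two paths (`n + 1`
of them, the factors may be trivial), each one listed once. -/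
def splits {a : V} : ∀ {b : V}, Quiver.Path a b →
    List (Σ c : V, Quiver.Path a c × Quiver.Path c b)
  | _, .nil => [⟨a, .nil, .nil⟩]
  | b, .cons p e =>
      (splits p).map (fun x => ⟨x.1, x.2.1, x.2.2.cons e⟩) ++ [⟨b, p.cons e, .nil⟩]

theorem comp_of_mem_splits {a b : V} (p : Quiver.Path a b) :
    ∀ x ∈ splits p, x.2.1.comp x.2.2 = p := by
  induction p with
  | nil => simp [splits]
  | cons p e ih =>
    intro x hx
    simp only [splits, List.mem_append, List.mem_map, List.mem_singleton] at hx
    rcases hx with ⟨y, hy, rfl⟩ | rfl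
    · simp [ih y hy]
    · simp

theorem sum_splits_splits {M : Type*} [AddCommMonoid M] {a b : V} (p : Quiver.Path a b)
    (f : ∀ c d : V, Quiver.Path a c → Quiver.Path c d → Quiver.Path d b → M) :
    ((splits p).map fun x => ((splits x.2.1).map fun y => f y.1 x.1 y.2.1 y.2.2 x.2.2).sum).sum =
      ((splits p).map fun x =>
        ((splits x.2.2).map fun y => f x.1 y.1 x.2.1 y.2.1 y.2.2).sum).sum := by
  induction p with
  | nil => simp [splits]
  | cons p e ih =>
    simp only [splits, List.map_append, List.map_map, List.sum_append, Function.comp_def,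
      List.map_cons, List.map_nil, List.sum_cons, List.sum_nil, add_zero, List.sum_map_add]
    rw [ih (fun c d q r s => f c d q r (s.cons e))]
    simp only [add_assoc]

theorem sum_splits_left {M : Type*} [AddCommMonoid M] {a b : V} (p : Quiver.Path a b)
    (f : ∀ c : V, Quiver.Path a c → Quiver.Path c b → M)
    (hf : ∀ c q r, q.length ≠ 0 → f c q r = 0) :
    ((splits p).map fun x => f x.1 x.2.1 x.2.2).sum = f a .nil p := by
  induction p with
  | nil => simp [splits]
  | cons p e ih =>
    simp only [splits, List.map_append, List.map_map, List.sum_append, Function.comp_def,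
      List.map_cons, List.map_nil, List.sum_cons, List.sum_nil, add_zero]
    rw [ih (fun c q r => f c q (r.cons e)) (fun c q r h => hf _ _ _ h), hf _ (p.cons e) _ (by simp),
      add_zero]

theorem sum_splits_right {M : Type*} [AddCommMonoid M] {a b : V} (p : Quiver.Path a b)
    (f : ∀ c : V, Quiver.Path a c → Quiver.Path c b → M)
    (hf : ∀ c q r, r.length ≠ 0 → f c q r = 0) :
    ((splits p).map fun x => f x.1 x.2.1 x.2.2).sum = f b p .nil := by
  cases p with
  | nil => simp [splits]
  | cons p e =>
    simp only [splits, List.map_append, List.map_map, List.sum_append, Function.comp_def,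
      List.map_cons, List.map_nil, List.sum_cons, List.sum_nil, add_zero]
    rw [List.sum_eq_zero, zero_add]
    intro x hx
    obtain ⟨y, _, rfl⟩ := List.mem_map.1 hx
    exact hf _ _ _ (by simp)

end

variable (k : Type u) [Field k] (V : Type v) [Quiver.{w} V] (N : ℕ∞)

instance instAddCommGroup : AddCommGroup (PathCoalgebra k V N) :=
  inferInstanceAs (AddCommGroup (PathUpTo V N →₀ k))

instance instModule : Module k (PathCoalgebra k V N) :=
  inferInstanceAs (Module k (PathUpTo V N →₀ k))

/-- The basis of paths. -/
def basis : Module.Basis (PathUpTo V N) k (PathCoalgebra k V N) :=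
  .ofRepr (LinearEquiv.refl k (PathUpTo V N →₀ k))

variable {V}

open Classical in
/-- A path seen in the (truncated) path coalgebra: the basis vector of the path if its length is at
most `N`, and `0` otherwise. -/
def ofPath {a b : V} (p : Quiver.Path a b) : PathCoalgebra k V N :=
  if h : (p.length : ℕ∞) ≤ N then basis k V N ⟨a, b, p, h⟩ else 0

variable (V)

/-- `Δ(p) = ∑_{p = q r} q ⊗ r` and `ε(e_i) = 1`, `ε(p) = 0` for `p` nontrivial. -/
instance instCoalgebraStruct : CoalgebraStruct k (PathCoalgebra k V N) where
  comul := (basis k V N).constr k fun p =>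
    ((splits p.path).map fun x => ofPath k N x.2.1 ⊗ₜ[k] ofPath k N x.2.2).sum
  counit := (basis k V N).constr k fun p => if p.path.length = 0 then 1 else 0

variable {V}

theorem comul_ofPath {a b : V} (p : Quiver.Path a b) (h : (p.length : ℕ∞) ≤ N) :
    Coalgebra.comul (R := k) (ofPath k N p) =
      ((splits p).map fun x => ofPath k N x.2.1 ⊗ₜ[k] ofPath k N x.2.2).sum := by
  rw [ofPath, dif_pos h]
  exact (basis k V N).constr_basis k _ _

theorem counit_ofPath {a b : V} (p : Quiver.Path a b) (h : (p.length : ℕ∞) ≤ N) :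
    Coalgebra.counit (R := k) (ofPath k N p) = if p.length = 0 then 1 else 0 := by
  rw [ofPath, dif_pos h]
  exact (basis k V N).constr_basis k _ _

theorem basis_eq_ofPath (p : PathUpTo V N) : basis k V N p = ofPath k N p.path := by
  rw [ofPath, dif_pos p.length_le]

theorem length_le_of_mem_splits {a b : V} {p : Quiver.Path a b} (h : (p.length : ℕ∞) ≤ N)
    {x : Σ c : V, Quiver.Path a c × Quiver.Path c b} (hx : x ∈ splits p) :
    (x.2.1.length : ℕ∞) ≤ N ∧ (x.2.2.length : ℕ∞) ≤ N := by
  have := congrArg Quiver.Path.length (comp_of_mem_splits p x hx)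
  rw [Quiver.Path.length_comp] at this
  constructor <;> refine le_trans ?_ h <;> exact_mod_cast (by omega)

variable (V)

instance instCoalgebra : Coalgebra k (PathCoalgebra k V N) where
  coassoc := by
    refine (basis k V N).ext fun p => ?_
    have hp := p.length_le
    simp only [basis_eq_ofPath, LinearMap.comp_apply, comul_ofPath k N _ hp, map_list_sum,
      List.map_map, Function.comp_def, LinearMap.rTensor_tmul, LinearMap.lTensor_tmul,
      LinearEquiv.coe_coe]
    have h1 : ∀ x ∈ splits p.path,
        TensorProduct.assoc k _ _ _ (Coalgebra.comul (R := k) (ofPath k N x.2.1) ⊗ₜ[k]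
          ofPath k N x.2.2) =
        ((splits x.2.1).map fun y => ofPath k N y.2.1 ⊗ₜ[k] (ofPath k N y.2.2 ⊗ₜ[k]
          ofPath k N x.2.2)).sum := fun x hx => by
      rw [comul_ofPath k N _ (length_le_of_mem_splits N hp hx).1]
      induction splits x.2.1 with
      | nil => simp
      | cons y l ih => simp [TensorProduct.add_tmul, ih]
    have h2 : ∀ x ∈ splits p.path,
        (ofPath k N x.2.1 ⊗ₜ[k] Coalgebra.comul (R := k) (ofPath k N x.2.2)) =
        ((splits x.2.2).map fun y => ofPath k N x.2.1 ⊗ₜ[k] (ofPath k N y.2.1 ⊗ₜ[k]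
          ofPath k N y.2.2)).sum := fun x hx => by
      rw [comul_ofPath k N _ (length_le_of_mem_splits N hp hx).2]
      induction splits x.2.2 with
      | nil => simp
      | cons y l ih => simp [TensorProduct.tmul_add, ih]
    rw [List.map_congr_left h1, List.map_congr_left h2]
    exact sum_splits_splits p.path
      (fun _ _ q r s => ofPath k N q ⊗ₜ[k] (ofPath k N r ⊗ₜ[k] ofPath k N s))
  rTensor_counit_comp_comul := by
    refine (basis k V N).ext fun p => ?_
    have hp := p.length_le
    simp only [basis_eq_ofPath, LinearMap.comp_apply, comul_ofPath k N _ hp, map_list_sum,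
      List.map_map, Function.comp_def, LinearMap.rTensor_tmul, TensorProduct.mk_apply]
    have h1 : ∀ x ∈ splits p.path,
        (Coalgebra.counit (R := k) (ofPath k N x.2.1) ⊗ₜ[k] ofPath k N x.2.2) =
        ((if x.2.1.length = 0 then (1 : k) else 0) ⊗ₜ[k] ofPath k N x.2.2) := fun x hx => by
      rw [counit_ofPath k N _ (length_le_of_mem_splits N hp hx).1]
    rw [List.map_congr_left h1]
    refine (sum_splits_left p.path
      (fun _ q r => (if q.length = 0 then (1 : k) else 0) ⊗ₜ[k] ofPath k N r) ?_).trans (by simp)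
    intro c q r h
    simp [h]
  lTensor_counit_comp_comul := by
    refine (basis k V N).ext fun p => ?_
    have hp := p.length_le
    simp only [basis_eq_ofPath, LinearMap.comp_apply, comul_ofPath k N _ hp, map_list_sum,
      List.map_map, Function.comp_def, LinearMap.lTensor_tmul, TensorProduct.mk_apply,
      LinearMap.flip_apply]
    have h1 : ∀ x ∈ splits p.path,
        (ofPath k N x.2.1 ⊗ₜ[k] Coalgebra.counit (R := k) (ofPath k N x.2.2)) =
        (ofPath k N x.2.1 ⊗ₜ[k] (if x.2.2.length = 0 then (1 : k) else 0)) := fun x hx => by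
      rw [counit_ofPath k N _ (length_le_of_mem_splits N hp hx).2]
    rw [List.map_congr_left h1]
    refine (sum_splits_right p.path
      (fun _ q r => ofPath k N q ⊗ₜ[k] (if r.length = 0 then (1 : k) else 0)) ?_).trans (by simp)
    intro c q r h
    simp [h]

end PathCoalgebra

/-! ## The automorphism group of a coalgebra as a group functor -/

/-- The group of coalgebra automorphisms, with composition as multiplication. -/
instance CoalgEquiv.instGroupAut (R : Type*) [CommRing R] (A : Type*) [AddCommGroup A] [Module R A]
    [Coalgebra R A] : Group (A ≃ₗc[R] A) where
  mul f g := g.trans f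
  one := CoalgEquiv.refl R A
  inv f := f.symm
  mul_assoc _ _ _ := rfl
  one_mul _ := rfl
  mul_one _ := rfl
  inv_mul_cancel f := CoalgEquiv.ext fun x => f.symm_apply_apply x

namespace CoalgAut

variable {k : Type u} [Field k] (C : Type v) [AddCommGroup C] [Module k C]
  {R S T : Type u} [CommRing R] [Algebra k R] [CommRing S] [Algebra k S] [CommRing T] [Algebra k T]

/-- The map `φ ⊗ id : R ⊗ C → S ⊗ C`, as a `φ`-semilinear map. -/
def scalarExt (φ : R →ₐ[k] S) : R ⊗[k] C →ₛₗ[(φ : R →+* S)] S ⊗[k] C where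
  toFun := φ.toLinearMap.rTensor C
  map_add' := map_add _
  map_smul' r x := by
    induction x with
    | zero => simp
    | tmul a c => simp [TensorProduct.smul_tmul']
    | add x y hx hy => simp only [smul_add, map_add, hx, hy]

variable {C}

@[simp] theorem scalarExt_tmul (φ : R →ₐ[k] S) (r : R) (c : C) :
    scalarExt C φ (r ⊗ₜ c) = φ r ⊗ₜ c := rfl

/-- The base change along `φ : R → S` of an `R`-linear endomorphism `f` of `R ⊗ C`: the unique
`S`-linear endomorphism of `S ⊗ C` with `1 ⊗ c ↦ (φ ⊗ id) (f (1 ⊗ c))`. -/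
def baseChangeLin (φ : R →ₐ[k] S) (f : R ⊗[k] C →ₗ[R] R ⊗[k] C) : S ⊗[k] C →ₗ[S] S ⊗[k] C :=
  LinearMap.liftBaseChange S
    { toFun := fun c => scalarExt C φ (f (1 ⊗ₜ c))
      map_add' := fun c d => by simp [TensorProduct.tmul_add]
      map_smul' := fun a c => by
        have h : (1 : R) ⊗ₜ[k] (a • c) = algebraMap k R a • ((1 : R) ⊗ₜ[k] c) := by
          rw [algebraMap_smul, TensorProduct.tmul_smul]
        rw [h, map_smul, map_smulₛₗ]
        simp }

theorem baseChangeLin_scalarExt (φ : R →ₐ[k] S) (f : R ⊗[k] C →ₗ[R] R ⊗[k] C) (x : R ⊗[k] C) :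
    baseChangeLin φ f (scalarExt C φ x) = scalarExt C φ (f x) := by
  induction x with
  | zero => simp
  | add x y hx hy => simp only [map_add, hx, hy]
  | tmul r c =>
    have h : r ⊗ₜ[k] c = r • ((1 : R) ⊗ₜ[k] c) := by simp [TensorProduct.smul_tmul']
    rw [scalarExt_tmul, baseChangeLin, LinearMap.liftBaseChange_tmul, h, map_smul, map_smulₛₗ]
    rfl

/-- Two `S`-linear maps out of `S ⊗ C` agree if they agree on the image of `R ⊗ C`. -/
theorem ext_scalarExt (φ : R →ₐ[k] S) {M : Type*} [AddCommMonoid M] [Module S M]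
    {f g : S ⊗[k] C →ₗ[S] M} (h : ∀ x : R ⊗[k] C, f (scalarExt C φ x) = g (scalarExt C φ x)) :
    f = g := by
  refine LinearMap.ext fun y => ?_
  induction y with
  | zero => simp
  | add x y hx hy => simp only [map_add, hx, hy]
  | tmul s c =>
    have hs : s ⊗ₜ[k] c = s • scalarExt C φ ((1 : R) ⊗ₜ[k] c) := by simp [TensorProduct.smul_tmul']
    rw [hs, map_smul, map_smul, h]

variable [Coalgebra k C]

theorem comul_scalarExt (φ : R →ₐ[k] S) (x : R ⊗[k] C) :
    Coalgebra.comul (R := S) (scalarExt C φ x) =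
      TensorProduct.map (scalarExt C φ) (scalarExt C φ) (Coalgebra.comul (R := R) x) := by
  induction x with
  | zero => simp
  | add x y hx hy => simp only [map_add, hx, hy]
  | tmul r c =>
    simp only [scalarExt_tmul, TensorProduct.comul_tmul, CommSemiring.comul_apply]
    induction Coalgebra.comul (R := k) c with
    | zero => simp
    | add x y hx hy => simp only [TensorProduct.tmul_add, map_add, hx, hy]
    | tmul c d => simp

theorem counit_scalarExt (φ : R →ₐ[k] S) (x : R ⊗[k] C) :
    Coalgebra.counit (R := S) (scalarExt C φ x) = φ (Coalgebra.counit (R := R) x) := by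
  induction x with
  | zero => simp
  | add x y hx hy => simp only [map_add, hx, hy]
  | tmul r c => simp

theorem map_baseChangeLin_comp_comul (φ : R →ₐ[k] S) (f : (R ⊗[k] C) ≃ₗc[R] (R ⊗[k] C)) :
    TensorProduct.map (baseChangeLin φ (f : R ⊗[k] C →ₗ[R] R ⊗[k] C))
        (baseChangeLin φ (f : R ⊗[k] C →ₗ[R] R ⊗[k] C)) ∘ₗ Coalgebra.comul (R := S) =
      Coalgebra.comul (R := S) ∘ₗ baseChangeLin φ (f : R ⊗[k] C →ₗ[R] R ⊗[k] C) := by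
  refine ext_scalarExt φ fun x => ?_
  have h : TensorProduct.map (f : R ⊗[k] C →ₗ[R] R ⊗[k] C) (f : R ⊗[k] C →ₗ[R] R ⊗[k] C)
      (Coalgebra.comul (R := R) x) = Coalgebra.comul (R := R)
        ((f : R ⊗[k] C →ₗ[R] R ⊗[k] C) x) :=
    LinearMap.congr_fun f.map_comp_comul x
  rw [LinearMap.comp_apply, LinearMap.comp_apply, baseChangeLin_scalarExt,
    comul_scalarExt, comul_scalarExt, ← h]
  generalize (Coalgebra.comul (R := R) x) = y
  induction y with
  | zero => simp only [map_zero]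
  | add x y hx hy => simp only [map_add, hx, hy]
  | tmul c d => simp only [TensorProduct.map_tmul, baseChangeLin_scalarExt]

theorem counit_comp_baseChangeLin (φ : R →ₐ[k] S) (f : (R ⊗[k] C) ≃ₗc[R] (R ⊗[k] C)) :
    Coalgebra.counit (R := S) ∘ₗ baseChangeLin φ (f : R ⊗[k] C →ₗ[R] R ⊗[k] C) =
      Coalgebra.counit (R := S) := by
  refine ext_scalarExt φ fun x => ?_
  rw [LinearMap.comp_apply, baseChangeLin_scalarExt, counit_scalarExt, counit_scalarExt]
  exact congrArg φ (LinearMap.congr_fun f.counit_comp x)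

/-- The base change of an automorphism of the `R`-coalgebra `R ⊗ C` along `φ : R → S`. -/
def baseChange (φ : R →ₐ[k] S) (f : (R ⊗[k] C) ≃ₗc[R] (R ⊗[k] C)) :
    (S ⊗[k] C) ≃ₗc[S] (S ⊗[k] C) where
  toLinearMap := baseChangeLin φ (f : R ⊗[k] C →ₗ[R] R ⊗[k] C)
  counit_comp := counit_comp_baseChangeLin φ f
  map_comp_comul := map_baseChangeLin_comp_comul φ f
  invFun := baseChangeLin φ (f.symm : R ⊗[k] C →ₗ[R] R ⊗[k] C)
  left_inv := by
    refine LinearMap.congr_fun (f := baseChangeLin φ (f.symm : R ⊗[k] C →ₗ[R] R ⊗[k] C) ∘ₗ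
      baseChangeLin φ (f : R ⊗[k] C →ₗ[R] R ⊗[k] C)) (g := LinearMap.id) ?_
    refine ext_scalarExt φ fun x => ?_
    rw [LinearMap.comp_apply, baseChangeLin_scalarExt, baseChangeLin_scalarExt]
    exact congrArg (scalarExt C φ) (f.symm_apply_apply x)
  right_inv := by
    refine LinearMap.congr_fun (f := baseChangeLin φ (f : R ⊗[k] C →ₗ[R] R ⊗[k] C) ∘ₗ
      baseChangeLin φ (f.symm : R ⊗[k] C →ₗ[R] R ⊗[k] C)) (g := LinearMap.id) ?_
    refine ext_scalarExt φ fun x => ?_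
    rw [LinearMap.comp_apply, baseChangeLin_scalarExt, baseChangeLin_scalarExt]
    exact congrArg (scalarExt C φ) (f.apply_symm_apply x)

theorem baseChange_scalarExt (φ : R →ₐ[k] S) (f : (R ⊗[k] C) ≃ₗc[R] (R ⊗[k] C)) (x : R ⊗[k] C) :
    baseChange φ f (scalarExt C φ x) = scalarExt C φ (f x) :=
  baseChangeLin_scalarExt φ (f : R ⊗[k] C →ₗ[R] R ⊗[k] C) x

/-- Automorphisms of the `S`-coalgebra `S ⊗ C` agree if they agree on the image of `R ⊗ C`. -/
theorem aut_ext (φ : R →ₐ[k] S) {f g : (S ⊗[k] C) ≃ₗc[S] (S ⊗[k] C)}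
    (h : ∀ x : R ⊗[k] C, f (scalarExt C φ x) = g (scalarExt C φ x)) : f = g := by
  have : (f : S ⊗[k] C →ₗ[S] S ⊗[k] C) = (g : S ⊗[k] C →ₗ[S] S ⊗[k] C) := ext_scalarExt φ h
  exact CoalgEquiv.ext fun x => LinearMap.congr_fun this x

/-- Base change of automorphisms is a group homomorphism. -/
def baseChangeHom (φ : R →ₐ[k] S) :
    ((R ⊗[k] C) ≃ₗc[R] (R ⊗[k] C)) →* ((S ⊗[k] C) ≃ₗc[S] (S ⊗[k] C)) :=
  MonoidHom.mk' (baseChange φ) fun f g => aut_ext φ fun x => by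
    rw [baseChange_scalarExt]
    change _ = baseChange φ f (baseChange φ g _)
    rw [baseChange_scalarExt, baseChange_scalarExt]
    rfl

end CoalgAut

/-- The automorphism group functor `R ↦ Aut_R(R ⊗ C)` of a `k`-coalgebra `C`, from commutative
`k`-algebras to groups. Its group of `k`-points is `Aut_k(k ⊗ C) = Aut(C)`. -/
def coalgAutFunctor (k : Type u) [Field k] (C : Type v) [AddCommGroup C] [Module k C]
    [Coalgebra k C] : CommAlgCat.{u} k ⥤ GrpCat.{max u v} where
  obj R := GrpCat.of ((R ⊗[k] C) ≃ₗc[R] (R ⊗[k] C))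
  map {R S} φ := GrpCat.ofHom (CoalgAut.baseChangeHom (C := C) φ.hom)
  map_id R := by
    refine GrpCat.hom_ext (MonoidHom.ext fun f => ?_)
    refine CoalgAut.aut_ext (AlgHom.id k R) fun x => ?_
    refine (CoalgAut.baseChange_scalarExt (AlgHom.id k R) f x).trans ?_
    have h : ∀ y : R ⊗[k] C, CoalgAut.scalarExt C (AlgHom.id k R) y = y := fun y => by
      change (AlgHom.id k R).toLinearMap.rTensor C y = y
      simp
    rw [h, h]
    rfl
  map_comp {R S T} φ ψ := by
    refine GrpCat.hom_ext (MonoidHom.ext fun f => ?_)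
    refine CoalgAut.aut_ext (ψ.hom.comp φ.hom) fun x => ?_
    refine (CoalgAut.baseChange_scalarExt (ψ.hom.comp φ.hom) f x).trans ?_
    have h : ∀ y : R ⊗[k] C, CoalgAut.scalarExt C (ψ.hom.comp φ.hom) y =
        CoalgAut.scalarExt C ψ.hom (CoalgAut.scalarExt C φ.hom y) := fun y => by
      change (ψ.hom.comp φ.hom).toLinearMap.rTensor C y =
        ψ.hom.toLinearMap.rTensor C (φ.hom.toLinearMap.rTensor C y)
      rw [AlgHom.comp_toLinearMap, LinearMap.rTensor_comp]
      rfl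
    rw [h, h]
    refine Eq.trans ?_ (CoalgAut.baseChange_scalarExt ψ.hom _ _).symm
    exact congrArg _ (CoalgAut.baseChange_scalarExt φ.hom f x).symm

/-! ## Linear algebraic groups -/

/-- A group functor on commutative `k`-algebras is a linear (i.e. affine) algebraic group over `k`
of dimension `d` if it is represented by a finitely generated commutative `k`-algebra `H`, the
coordinate ring, of Krull dimension `d`. (By Yoneda's lemma `H` is unique up to isomorphism, and the
group structure of the functor is the same thing as a Hopf algebra structure on `H`.) -/
def IsLinearAlgebraicGroupOfDim {k : Type u} [Field k] (G : CommAlgCat.{u} k ⥤ GrpCat.{w})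
    (d : ℕ) : Prop :=
  ∃ H : CommAlgCat.{u} k, Algebra.FiniteType k H ∧
    Nonempty ((G ⋙ forget GrpCat).CorepresentableBy H) ∧ ringKrullDim H = d

end

/-!
# The dimension of the automorphism group of a (truncated) path coalgebra

Both cases concern a length bound `N : ℕ∞` for which there are only finitely many paths of length
at most `N`: for `N = n` finite this always holds, and for `N = ⊤` it holds when the quiver is
acyclic, since the number of predecessors grows strictly along a path.

*Representability.* For a coalgebra with a finite basis, an automorphism of `R ⊗ C` is a pair of
mutually inverse matrices over `R` subject to polynomial equations with coefficients in `k`. Hence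
the automorphism functor is represented by a quotient `AutCoordRing` of a polynomial ring, and only
its Krull dimension remains to be found. By transposition, these matrices are the automorphisms of
the dual algebra, here the truncated path algebra `PathAlg` over `R`, with its vertex idempotents
`e_i` and its nilpotent arrow ideal `J`.

*Upper bound.* The automorphism group need not be connected, nor reduced (a loop may be translated
by nilpotents in positive characteristic), so the dimension is bounded on the quotients `K` of the
coordinate ring by primes. Over the domain `K`, an automorphism `φ` preserves `J`, because `J`
is exactly the set of nilpotent elements, and it induces a permutation `σ` of the vertices, because
modulo `J` the algebra is a product of copies of `K`. There is a unique unipotent `v` with block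
diagonal part `1` and `φ(e_i) v = v e_{σ i}` (`exists_conjugator`, `conjugator_unique`); it has
`∑_{s ≠ t} |P_{s,t}|` coefficients. The conjugate `v⁻¹ φ v` sends an arrow `a : s ⟶ t` to an element
of `e_{σ s} J e_{σ t}`, which accounts for `|(Q₁)_{s,t}| |P_{σ s, σ t}|` further coefficients, and
`|P_{σ s, σ t}| = |P_{s,t}|` because `v⁻¹ φ v` embeds `e_s J e_t` into `e_{σ s} J e_{σ t}`. All
matrix entries of `φ` are polynomials in these coordinates, whose number is the asserted dimension;
the entries of `φ⁻¹` require in addition only the inverse of the determinant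
(`exists_coordinates`, `ringKrullDim_le_of_isAutMatrix`).

*Lower bound.* Conversely, over the polynomial ring in these coordinates (for `σ = 1`) there is a
generic endomorphism (`exists_substitution`), which becomes invertible over the principal open
subset where its determinant `g` is invertible. This subset contains the identity, so it has full
dimension, and the uniqueness of `v` shows that it is a closed subscheme of the automorphism group
(`le_ringKrullDim_autCoordRing`).
-/

noncomputable section

/-! ### Krull dimension -/

/-- The Krull dimension is bounded by the dimensions of the integral quotients: a chain of primes
lives in the quotient by its smallest member. -/
theorem ringKrullDim_le_of_forall_quotient_isPrime {R : Type*} [CommRing R] {d : WithBot ℕ∞}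
    (h : ∀ p : Ideal R, p.IsPrime → ringKrullDim (R ⧸ p) ≤ d) : ringKrullDim R ≤ d := by
  refine iSup_le fun l => ?_
  refine le_trans ?_ (h l.head.asIdeal l.head.isPrime)
  rw [ringKrullDim_quotient]
  let l' : LTSeries (PrimeSpectrum.zeroLocus (R := R) (l.head.asIdeal : Set R)) :=
    LTSeries.mk l.length (fun i => ⟨l i, l.monotone (Fin.zero_le i)⟩) fun i j hij =>
      l.strictMono hij
  exact le_iSup (fun q : LTSeries (PrimeSpectrum.zeroLocus (R := R) (l.head.asIdeal : Set R)) =>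
    ((q.length : ℕ∞) : WithBot ℕ∞)) l'

theorem ringKrullDim_localization_le {R : Type*} [CommRing R] (M : Submonoid R) (S : Type*)
    [CommRing S] [Algebra R S] [IsLocalization M S] : ringKrullDim S ≤ ringKrullDim R := by
  rw [ringKrullDim_le_iff_height_le]
  intro p hp
  rw [← IsLocalization.height_under M p]
  exact (ringKrullDim_le_iff_height_le _).1 le_rfl (hp.under R)

/-- The origin of affine space has height at least the number of coordinates. -/
theorem card_le_height_ker_constantCoeff (k : Type*) [Field k] (T : Type*) [Finite T] :
    (Nat.card T : ℕ∞) ≤ (RingHom.ker (MvPolynomial.constantCoeff (R := k) (σ := T))).height := by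
  classical
  let e : T ≃ Fin (Nat.card T) := Finite.equivFin T
  -- `h i` kills the first `i` variables
  let h : Fin (Nat.card T + 1) → MvPolynomial T k →ₐ[k] MvPolynomial T k := fun i =>
    MvPolynomial.aeval fun t => if (e t).castSucc < i then 0 else MvPolynomial.X t
  have hX : ∀ i t, h i (MvPolynomial.X t) =
      if (e t).castSucc < i then 0 else MvPolynomial.X t := fun i t => by simp [h]
  have hcomp : ∀ i j, i ≤ j → (h j).comp (h i) = h j := fun i j hij => by
    refine MvPolynomial.algHom_ext fun t => ?_
    rw [AlgHom.comp_apply, hX, hX]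
    split_ifs with h1 h2 h2
    · simp
    · exact absurd (h1.trans_le hij) h2
    · rw [hX, if_pos h2]
    · rw [hX, if_neg h2]
  have hprime : ∀ i, (RingHom.ker (h i)).IsPrime := fun i => RingHom.ker_isPrime _
  let P : Fin (Nat.card T + 1) → PrimeSpectrum (MvPolynomial T k) := fun i => ⟨_, hprime i⟩
  have hP : StrictMono P := by
    intro i j hij
    refine lt_of_le_of_ne ?_ ?_
    · intro x (hx : h i x = 0)
      change h j x = 0
      rw [← hcomp i j hij.le, AlgHom.comp_apply, hx, map_zero]
    · intro heq
      have hi : (i : ℕ) < Nat.card T := lt_of_lt_of_le hij (Nat.le_of_lt_succ j.2)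
      have h1 : MvPolynomial.X (e.symm ⟨i, hi⟩) ∈ (P j).asIdeal := by
        change h j _ = 0
        rw [hX, if_pos]
        simpa using hij
      rw [← heq] at h1
      change h i _ = 0 at h1
      rw [hX, if_neg (by simp)] at h1
      exact MvPolynomial.X_ne_zero _ h1
  have hlast : (P (Fin.last _)).asIdeal =
      RingHom.ker (MvPolynomial.constantCoeff (R := k) (σ := T)) := by
    ext x
    change h _ x = 0 ↔ MvPolynomial.constantCoeff x = 0
    have : h (Fin.last _) = (Algebra.ofId k _).comp (MvPolynomial.aeval (0 : T → k)) := by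
      refine MvPolynomial.algHom_ext fun t => ?_
      rw [hX, if_pos (Fin.castSucc_lt_last _)]
      simp
    rw [this, AlgHom.comp_apply, MvPolynomial.aeval_zero]
    exact map_eq_zero_iff _ (algebraMap k (MvPolynomial T k)).injective
  rw [← hlast, PrimeSpectrum.height_eq_orderHeight]
  exact Order.length_le_height_last (p := LTSeries.mk _ P hP)

/-- A nonempty principal open subset of affine space through the origin has full dimension. -/
theorem card_le_ringKrullDim_localizationAway {k : Type*} [Field k] {T : Type*} [Finite T]
    (g : MvPolynomial T k) (hg : MvPolynomial.constantCoeff g ≠ 0) :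
    (Nat.card T : WithBot ℕ∞) ≤ ringKrullDim (Localization.Away g) := by
  have hdis : Disjoint (Submonoid.powers g : Set (MvPolynomial T k))
      (RingHom.ker (MvPolynomial.constantCoeff (R := k) (σ := T))) := by
    rw [Set.disjoint_left]
    rintro _ ⟨n, rfl⟩ hx
    have hx' : MvPolynomial.constantCoeff (g ^ n) = 0 := hx
    rw [map_pow] at hx'
    exact pow_ne_zero n hg hx'
  have hp : (RingHom.ker (MvPolynomial.constantCoeff (R := k) (σ := T))).IsPrime :=
    RingHom.ker_isPrime _
  have h1 := IsLocalization.height_map_of_disjoint (S := Localization.Away g)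
    (Submonoid.powers g) _ hdis
  have h2 := IsLocalization.isPrime_of_isPrime_disjoint (Submonoid.powers g)
    (Localization.Away g) _ hp hdis
  refine le_trans ?_ ((ringKrullDim_le_iff_height_le _).1 le_rfl h2)
  rw [h1]
  exact_mod_cast card_le_height_ker_constantCoeff k T

/-- An algebra generated by `x₁, …, x_m` and the inverse of a polynomial in the `xᵢ` has dimension
at most `m`. -/
theorem ringKrullDim_le_card_of_generated {k : Type*} [Field k] {T : Type*} [Finite T]
    {K : Type*} [CommRing K] [Algebra k K] (x : T → K) {a b : K}
    (ha : a ∈ Algebra.adjoin k (Set.range x)) (hab : a * b = 1)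
    (hgen : Algebra.adjoin k (insert b (Set.range x)) = ⊤) :
    ringKrullDim K ≤ Nat.card T := by
  rw [← MvPolynomial.aeval_range] at ha
  obtain ⟨g, rfl⟩ := ha
  have hu : IsUnit (MvPolynomial.aeval (R := k) x g) := IsUnit.of_mul_eq_one _ hab
  let ψ : Localization.Away g →+* K := IsLocalization.Away.lift (S := Localization.Away g) g
    (g := ((MvPolynomial.aeval (R := k) x : MvPolynomial T k →ₐ[k] K) : MvPolynomial T k →+* K)) hu
  have hψ : ∀ f, ψ (algebraMap _ _ f) = MvPolynomial.aeval (R := k) x f := fun f =>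
    IsLocalization.Away.lift_eq g hu f
  have hsurj : Function.Surjective ψ := by
    rw [← RingHom.range_eq_top, eq_top_iff]
    intro y _
    have hy : y ∈ Algebra.adjoin k (insert b (Set.range x)) := hgen ▸ Algebra.mem_top
    induction hy using Algebra.adjoin_induction with
    | mem z hz =>
      rcases hz with rfl | ⟨t, rfl⟩
      · refine ⟨IsLocalization.Away.invSelf g, ?_⟩
        have h1 := congrArg ψ (IsLocalization.Away.mul_invSelf (S := Localization.Away g) g)
        rw [map_mul, hψ, map_one] at h1
        exact hu.mul_left_cancel (h1.trans hab.symm)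
      · exact ⟨algebraMap _ _ (MvPolynomial.X t), by rw [hψ]; simp⟩
    | algebraMap r => exact ⟨algebraMap _ _ (MvPolynomial.C r), by rw [hψ]; simp⟩
    | add y z _ _ hy hz => exact add_mem (hy trivial) (hz trivial)
    | mul y z _ _ hy hz => exact mul_mem (hy trivial) (hz trivial)
  refine (ringKrullDim_le_of_surjective ψ hsurj).trans ?_
  refine (ringKrullDim_localization_le (Submonoid.powers g) _).trans ?_
  rw [MvPolynomial.ringKrullDim_of_isNoetherianRing, ringKrullDim_eq_zero_of_field, zero_add]

/-! ### Matrices with entries in a subalgebra -/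

section Matrix

variable {k : Type*} [Field k] {m : ℕ}

theorem Matrix.det_mem_subalgebra {K : Type*} [CommRing K] [Algebra k K]
    (S : Subalgebra k K) {A : Matrix (Fin m) (Fin m) K} (hA : ∀ i j, A i j ∈ S) : A.det ∈ S := by
  rw [Matrix.det_apply]
  exact sum_mem fun τ _ => zsmul_mem (prod_mem fun i _ => hA _ _) _

/-- An inverse matrix has entries in any subalgebra that contains the entries of the matrix and the
inverse of its determinant. -/
theorem Matrix.inverse_mem_subalgebra {K : Type*} [CommRing K] [Algebra k K]
    (S : Subalgebra k K) {M M' : Matrix (Fin m) (Fin m) K} (h : M * M' = 1)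
    (hM : ∀ i j, M i j ∈ S) (hdet : M'.det ∈ S) (i j : Fin m) : M' i j ∈ S := by
  have h1 : M.det * M'.det = 1 := by rw [← Matrix.det_mul, h, Matrix.det_one]
  have h2 : M' = M'.det • M.adjugate := by
    calc M' = (M'.det * M.det) • M' := by rw [mul_comm, h1, one_smul]
      _ = M'.det • (M.adjugate * M * M') := by
        rw [Matrix.adjugate_mul, mul_smul, Matrix.smul_mul, one_mul]
      _ = M'.det • M.adjugate := by rw [mul_assoc, h, mul_one]
  rw [h2, Matrix.smul_apply, smul_eq_mul, Matrix.adjugate_apply]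
  refine mul_mem hdet (Matrix.det_mem_subalgebra S fun i' j' => ?_)
  rw [Matrix.updateRow_apply]
  split_ifs
  · rw [Pi.single_apply]
    split_ifs
    exacts [one_mem _, zero_mem _]
  · exact hM _ _

end Matrix

/-! ### The coordinate ring of the automorphism group of a finite-dimensional coalgebra -/

namespace CoalgAut

section StructureConstants

variable {k : Type*} [Field k] {C : Type*} [AddCommGroup C] [Module k C] [Coalgebra k C]
  {m : ℕ} (b : Module.Basis (Fin m) k C)

/-- The structure constants of a coalgebra: `Δ (b p) = ∑ q r, structConst b p q r • b q ⊗ b r`. -/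
def structConst (p q r : Fin m) : k :=
  (b.tensorProduct b).repr (Coalgebra.comul (b p)) (q, r)

theorem comul_eq_sum_structConst (p : Fin m) :
    Coalgebra.comul (R := k) (b p) = ∑ q, ∑ r, structConst b p q r • (b q ⊗ₜ[k] b r) := by
  rw [← (b.tensorProduct b).sum_repr (Coalgebra.comul (b p)), Fintype.sum_prod_type]
  simp [structConst, Module.Basis.tensorProduct_apply]

/-- `M` is the matrix of an endomorphism of the `R`-coalgebra `R ⊗ C`: row `p` holds the
coordinates of the image of `1 ⊗ b p`. -/
structure IsCoalgMatrix {R : Type*} [CommRing R] [Algebra k R]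
    (M : Matrix (Fin m) (Fin m) R) : Prop where
  comul : ∀ p q r, ∑ s, M p s * algebraMap k R (structConst b s q r) =
    ∑ q', ∑ r', algebraMap k R (structConst b p q' r') * (M q' q * M r' r)
  counit : ∀ p, ∑ s, M p s * algebraMap k R (Coalgebra.counit (b s)) =
    algebraMap k R (Coalgebra.counit (b p))

/-- `M` is the matrix, with inverse `M'`, of an automorphism of the `R`-coalgebra `R ⊗ C`. -/
structure IsAutMatrix {R : Type*} [CommRing R] [Algebra k R]
    (M M' : Matrix (Fin m) (Fin m) R) : Prop extends IsCoalgMatrix b M where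
  mul_inv : M * M' = 1
  inv_mul : M' * M = 1

variable {b} in
theorem IsCoalgMatrix.map {R S : Type*} [CommRing R] [Algebra k R] [CommRing S] [Algebra k S]
    {M : Matrix (Fin m) (Fin m) R} (h : IsCoalgMatrix b M) (φ : R →ₐ[k] S) :
    IsCoalgMatrix b (M.map φ) where
  comul p q r := by
    have := congrArg φ (h.comul p q r)
    simpa [map_sum] using this
  counit p := by
    have := congrArg φ (h.counit p)
    simpa [map_sum] using this

variable {b} in
theorem IsAutMatrix.map {R S : Type*} [CommRing R] [Algebra k R] [CommRing S] [Algebra k S]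
    {M M' : Matrix (Fin m) (Fin m) R} (h : IsAutMatrix b M M') (φ : R →ₐ[k] S) :
    IsAutMatrix b (M.map φ) (M'.map φ) where
  toIsCoalgMatrix := h.toIsCoalgMatrix.map φ
  mul_inv := by
    rw [← Matrix.map_mul, h.mul_inv, Matrix.map_one _ (map_zero φ) (map_one φ)]
  inv_mul := by
    rw [← Matrix.map_mul, h.inv_mul, Matrix.map_one _ (map_zero φ) (map_one φ)]

/-- The polynomial ring in the entries of a matrix and of its inverse. -/
abbrev MatrixPairPoly (k : Type*) [Field k] (m : ℕ) :=
  MvPolynomial ((Fin m × Fin m) ⊕ (Fin m × Fin m)) k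

/-- The generic matrix. -/
def genericMatrix (k : Type*) [Field k] (m : ℕ) : Matrix (Fin m) (Fin m) (MatrixPairPoly k m) :=
  Matrix.of fun p q => MvPolynomial.X (.inl (p, q))

/-- The generic matrix standing for the inverse. -/
def genericInverse (k : Type*) [Field k] (m : ℕ) : Matrix (Fin m) (Fin m) (MatrixPairPoly k m) :=
  Matrix.of fun p q => MvPolynomial.X (.inr (p, q))

/-- The equations of the automorphism group inside the space of pairs of matrices. -/
def autRelations : Set (MatrixPairPoly k m) :=
  let X := genericMatrix k m
  let X' := genericInverse k m
  let c := fun a : k => (MvPolynomial.C a : MatrixPairPoly k m)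
  ((Set.range fun i : Fin m × Fin m => (X * X' - 1) i.1 i.2) ∪
    (Set.range fun i : Fin m × Fin m => (X' * X - 1) i.1 i.2)) ∪
  ((Set.range fun i : Fin m × Fin m × Fin m =>
      ∑ s, X i.1 s * c (structConst b s i.2.1 i.2.2) -
        ∑ q', ∑ r', c (structConst b i.1 q' r') * (X q' i.2.1 * X r' i.2.2)) ∪
    (Set.range fun p : Fin m =>
      ∑ s, X p s * c (Coalgebra.counit (b s)) - c (Coalgebra.counit (b p))))

/-- A pair of matrices satisfies the equations exactly if it is an automorphism with its inverse. -/
theorem forall_autRelations_iff {R : Type*} [CommRing R] [Algebra k R]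
    (θ : MatrixPairPoly k m →ₐ[k] R) :
    (∀ f ∈ autRelations b, θ f = 0) ↔
      IsAutMatrix b ((genericMatrix k m).map θ) ((genericInverse k m).map θ) := by
  have hC : ∀ a : k, θ (MvPolynomial.C a) = algebraMap k R a := fun a => θ.commutes a
  have hone : ∀ i j : Fin m, θ ((1 : Matrix (Fin m) (Fin m) (MatrixPairPoly k m)) i j) =
      (1 : Matrix (Fin m) (Fin m) R) i j := fun i j => by
    rw [Matrix.one_apply, Matrix.one_apply]; split_ifs <;> simp
  simp only [autRelations, Set.mem_union, or_imp, forall_and, Set.forall_mem_range]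
  simp only [Prod.forall, map_sub, map_sum, map_mul, hC, sub_eq_zero,
    Matrix.sub_apply, Matrix.mul_apply, hone]
  constructor
  · rintro ⟨⟨h1, h2⟩, h3, h4⟩
    exact ⟨⟨h3, h4⟩, by ext i j; simpa [Matrix.mul_apply] using h1 i j,
      by ext i j; simpa [Matrix.mul_apply] using h2 i j⟩
  · rintro ⟨⟨h3, h4⟩, h1, h2⟩
    refine ⟨⟨fun i j => ?_, fun i j => ?_⟩, h3, h4⟩
    · rw [← h1]; simp [Matrix.mul_apply]
    · rw [← h2]; simp [Matrix.mul_apply]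

/-- The coordinate ring of the automorphism group of a coalgebra with a finite basis. The basis is
indexed by `Fin m`, so that the ring lives in the universe of `k`. -/
abbrev AutCoordRing := MatrixPairPoly k m ⧸ Ideal.span (autRelations b)

/-- The matrix of the universal automorphism. -/
def univMatrix : Matrix (Fin m) (Fin m) (AutCoordRing b) :=
  (genericMatrix k m).map (Ideal.Quotient.mkₐ k (Ideal.span (autRelations b)))

/-- The matrix of the inverse of the universal automorphism. -/
def univInverse : Matrix (Fin m) (Fin m) (AutCoordRing b) :=
  (genericInverse k m).map (Ideal.Quotient.mkₐ k (Ideal.span (autRelations b)))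

theorem isAutMatrix_univ : IsAutMatrix b (univMatrix b) (univInverse b) :=
  (forall_autRelations_iff b _).1 fun _ hf =>
    Ideal.Quotient.eq_zero_iff_mem.2 (Ideal.subset_span hf)

theorem adjoin_univMatrix :
    Algebra.adjoin k (Set.range (fun i : Fin m × Fin m => univMatrix b i.1 i.2) ∪
      Set.range (fun i : Fin m × Fin m => univInverse b i.1 i.2)) = ⊤ := by
  have h := congrArg (Subalgebra.map (Ideal.Quotient.mkₐ k (Ideal.span (autRelations b))))
    (MvPolynomial.adjoin_range_X (R := k) (σ := (Fin m × Fin m) ⊕ (Fin m × Fin m)))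
  rw [Algebra.map_top, (AlgHom.range_eq_top _).2 (Ideal.Quotient.mkₐ_surjective _ _),
    AlgHom.map_adjoin, ← Set.range_comp] at h
  rw [← h]
  congr 1
  ext x
  simp [univMatrix, univInverse, genericMatrix, genericInverse, Sum.exists]

/-- Algebra maps out of the coordinate ring agree if they agree on the universal matrices. -/
theorem autCoordRing_hom_ext {R : Type*} [CommRing R] [Algebra k R] {φ ψ : AutCoordRing b →ₐ[k] R}
    (h : (univMatrix b).map φ = (univMatrix b).map ψ)
    (h' : (univInverse b).map φ = (univInverse b).map ψ) : φ = ψ := by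
  refine AlgHom.ext_of_adjoin_eq_top (adjoin_univMatrix b) ?_
  rintro _ (⟨i, rfl⟩ | ⟨i, rfl⟩)
  · exact congrFun (congrFun h i.1) i.2
  · exact congrFun (congrFun h' i.1) i.2

variable {b} in
/-- The algebra map out of the coordinate ring that belongs to an automorphism over `R`. -/
theorem IsAutMatrix.exists_hom {R : Type*} [CommRing R] [Algebra k R]
    {M M' : Matrix (Fin m) (Fin m) R} (h : IsAutMatrix b M M') :
    ∃ φ : AutCoordRing b →ₐ[k] R, (univMatrix b).map φ = M ∧ (univInverse b).map φ = M' := by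
  let θ : MatrixPairPoly k m →ₐ[k] R :=
    MvPolynomial.aeval (Sum.elim (fun i => M i.1 i.2) fun i => M' i.1 i.2)
  have hM : (genericMatrix k m).map θ = M := by ext; simp [θ, genericMatrix]
  have hM' : (genericInverse k m).map θ = M' := by ext; simp [θ, genericInverse]
  have hθ : ∀ f ∈ autRelations b, θ f = 0 :=
    (forall_autRelations_iff b θ).2 (by rwa [hM, hM'])
  have hker : ∀ a ∈ Ideal.span (autRelations b), θ a = 0 := fun a ha =>
    (Ideal.span_le.2 hθ : Ideal.span (autRelations b) ≤ RingHom.ker θ) ha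
  refine ⟨Ideal.Quotient.liftₐ _ θ hker, ?_, ?_⟩
  · conv_rhs => rw [← hM]
    rfl
  · conv_rhs => rw [← hM']
    rfl

end StructureConstants

/-! ### Representability -/

section Representability

variable {k : Type u} [Field k] {C : Type v} [AddCommGroup C] [Module k C]
  {m : ℕ} (b : Module.Basis (Fin m) k C)

/-- The coordinates of the images of the basis vectors `1 ⊗ b p` under an endomorphism. -/
def coeffMatrix {R : Type u} [CommRing R] [Algebra k R] (f : R ⊗[k] C →ₗ[R] R ⊗[k] C) :
    Matrix (Fin m) (Fin m) R :=
  Matrix.of fun p q => (b.baseChange R).repr (f (1 ⊗ₜ b p)) q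

theorem apply_eq_sum_coeffMatrix {R : Type u} [CommRing R] [Algebra k R]
    (f : R ⊗[k] C →ₗ[R] R ⊗[k] C) (p : Fin m) :
    f (1 ⊗ₜ b p) = ∑ q, coeffMatrix b f p q • ((1 : R) ⊗ₜ[k] b q) := by
  conv_lhs => rw [← (b.baseChange R).sum_repr (f (1 ⊗ₜ b p))]
  simp [coeffMatrix]

theorem linearMap_ext_coeffMatrix {R : Type u} [CommRing R] [Algebra k R]
    {f g : R ⊗[k] C →ₗ[R] R ⊗[k] C} (h : coeffMatrix b f = coeffMatrix b g) : f = g := by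
  refine (b.baseChange R).ext fun p => ?_
  rw [Module.Basis.baseChange_apply, apply_eq_sum_coeffMatrix, h, ← apply_eq_sum_coeffMatrix]

theorem coeffMatrix_comp {R : Type u} [CommRing R] [Algebra k R]
    (f g : R ⊗[k] C →ₗ[R] R ⊗[k] C) :
    coeffMatrix b (f ∘ₗ g) = coeffMatrix b g * coeffMatrix b f := by
  ext p q
  conv_lhs => rw [coeffMatrix, Matrix.of_apply, LinearMap.comp_apply, apply_eq_sum_coeffMatrix b g]
  simp [Matrix.mul_apply, coeffMatrix]

theorem coeffMatrix_id {R : Type u} [CommRing R] [Algebra k R] :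
    coeffMatrix b (LinearMap.id : R ⊗[k] C →ₗ[R] R ⊗[k] C) = 1 := by
  ext p q
  simp [coeffMatrix, Matrix.one_apply, Finsupp.single_apply]

theorem exists_coeffMatrix_eq {R : Type u} [CommRing R] [Algebra k R]
    (M : Matrix (Fin m) (Fin m) R) :
    ∃ f : R ⊗[k] C →ₗ[R] R ⊗[k] C, coeffMatrix b f = M := by
  refine ⟨(b.baseChange R).constr R fun p => ∑ q, M p q • (b.baseChange R) q, ?_⟩
  ext p q
  have := (b.baseChange R).constr_basis R (fun p => ∑ q, M p q • (b.baseChange R) q) p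
  rw [Module.Basis.baseChange_apply] at this
  rw [coeffMatrix, Matrix.of_apply, this]
  simp [Finsupp.single_apply]

theorem repr_scalarExt {R S : Type u} [CommRing R] [Algebra k R] [CommRing S] [Algebra k S]
    (φ : R →ₐ[k] S) (x : R ⊗[k] C) (q : Fin m) :
    (b.baseChange S).repr (scalarExt C φ x) q = φ ((b.baseChange R).repr x q) := by
  induction x with
  | zero => simp
  | add x y hx hy => simp only [map_add, Finsupp.add_apply, hx, hy]
  | tmul r c => simp [Algebra.smul_def]

variable [Coalgebra k C]

theorem comul_one_tmul {R : Type u} [CommRing R] [Algebra k R] (p : Fin m) :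
    Coalgebra.comul (R := R) ((1 : R) ⊗ₜ[k] b p) = ∑ q, ∑ r, algebraMap k R (structConst b p q r) •
      (((1 : R) ⊗ₜ[k] b q) ⊗ₜ[R] ((1 : R) ⊗ₜ[k] b r)) := by
  rw [TensorProduct.comul_tmul, comul_eq_sum_structConst]
  simp only [TensorProduct.tmul_sum, map_sum, CommSemiring.comul_apply]
  refine Finset.sum_congr rfl fun q _ => Finset.sum_congr rfl fun r _ => ?_
  rw [algebraMap_smul, TensorProduct.tmul_smul]
  rw [← algebraMap_smul R, map_smul, algebraMap_smul]
  rfl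

/-- Compatibility with the comultiplication in terms of structure constants. -/
theorem comul_iff_coeffMatrix {R : Type u} [CommRing R] [Algebra k R]
    (f : R ⊗[k] C →ₗ[R] R ⊗[k] C) :
    TensorProduct.map f f ∘ₗ Coalgebra.comul = Coalgebra.comul ∘ₗ f ↔
      ∀ p q r, ∑ s, coeffMatrix b f p s * algebraMap k R (structConst b s q r) =
        ∑ q', ∑ r', algebraMap k R (structConst b p q' r') *
          (coeffMatrix b f q' q * coeffMatrix b f r' r) := by
  let β := b.baseChange R
  have hβ : ∀ p, β p = 1 ⊗ₜ b p := fun p => Module.Basis.baseChange_apply R b p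
  have hl : ∀ p q r, (β.tensorProduct β).repr ((Coalgebra.comul ∘ₗ f) (β p)) (q, r) =
      ∑ s, coeffMatrix b f p s * algebraMap k R (structConst b s q r) := fun p q r => by
    rw [LinearMap.comp_apply, hβ, apply_eq_sum_coeffMatrix b f p]
    simp only [map_sum, map_smul, Finsupp.finsetSum_apply, Finsupp.smul_apply, smul_eq_mul]
    refine Finset.sum_congr rfl fun s _ => congrArg _ ?_
    rw [comul_one_tmul]
    simp only [← hβ, map_sum, map_smul, Finsupp.finsetSum_apply, Finsupp.smul_apply,
      Module.Basis.tensorProduct_repr_tmul_apply, Module.Basis.repr_self, smul_eq_mul]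
    simp [Finsupp.single_apply]
  have hr : ∀ p q r, (β.tensorProduct β).repr
      ((TensorProduct.map f f ∘ₗ Coalgebra.comul) (β p)) (q, r) =
      ∑ q', ∑ r', algebraMap k R (structConst b p q' r') *
          (coeffMatrix b f q' q * coeffMatrix b f r' r) := fun p q r => by
    rw [LinearMap.comp_apply, hβ, comul_one_tmul]
    simp only [map_sum, map_smul, TensorProduct.map_tmul, Finsupp.finsetSum_apply,
      Finsupp.smul_apply, Module.Basis.tensorProduct_repr_tmul_apply, smul_eq_mul]
    refine Finset.sum_congr rfl fun q' _ => Finset.sum_congr rfl fun r' _ => ?_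
    change _ * (coeffMatrix b f r' r * coeffMatrix b f q' q) = _
    ring
  constructor
  · intro h p q r
    rw [← hl, ← hr, h]
  · intro h
    refine β.ext fun p => (β.tensorProduct β).repr.injective (Finsupp.ext fun ⟨q, r⟩ => ?_)
    rw [hl, hr, h]

theorem counit_iff_coeffMatrix {R : Type u} [CommRing R] [Algebra k R]
    (f : R ⊗[k] C →ₗ[R] R ⊗[k] C) :
    Coalgebra.counit ∘ₗ f = Coalgebra.counit ↔
      ∀ p, ∑ s, coeffMatrix b f p s * algebraMap k R (Coalgebra.counit (b s)) =
        algebraMap k R (Coalgebra.counit (b p)) := by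
  have h1 : ∀ p, Coalgebra.counit (R := R) ((1 : R) ⊗ₜ[k] b p) =
      algebraMap k R (Coalgebra.counit (b p)) := fun p => by
    simp [Algebra.algebraMap_eq_smul_one]
  have hl : ∀ p, (Coalgebra.counit ∘ₗ f) (1 ⊗ₜ b p) =
      ∑ s, coeffMatrix b f p s * algebraMap k R (Coalgebra.counit (b s)) := fun p => by
    rw [LinearMap.comp_apply, apply_eq_sum_coeffMatrix b f p]
    simp only [map_sum, map_smul, h1, smul_eq_mul]
  constructor
  · intro h p
    rw [← hl, h, h1]
  · intro h
    refine (b.baseChange R).ext fun p => ?_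
    rw [Module.Basis.baseChange_apply, hl, h, h1]

theorem isAutMatrix_coeffMatrix {R : Type u} [CommRing R] [Algebra k R]
    (f : (R ⊗[k] C) ≃ₗc[R] (R ⊗[k] C)) :
    IsAutMatrix b (coeffMatrix b (f : R ⊗[k] C →ₗ[R] R ⊗[k] C))
      (coeffMatrix b (f.symm : R ⊗[k] C →ₗ[R] R ⊗[k] C)) where
  mul_inv := by
    rw [← coeffMatrix_comp, ← coeffMatrix_id b]
    exact congrArg _ (LinearMap.ext fun x => f.symm_apply_apply x)
  inv_mul := by
    rw [← coeffMatrix_comp, ← coeffMatrix_id b]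
    exact congrArg _ (LinearMap.ext fun x => f.apply_symm_apply x)
  comul := (comul_iff_coeffMatrix b _).1 f.map_comp_comul
  counit := (counit_iff_coeffMatrix b _).1 f.counit_comp

variable {b} in
theorem IsAutMatrix.exists_coalgEquiv {R : Type u} [CommRing R] [Algebra k R]
    {M M' : Matrix (Fin m) (Fin m) R} (h : IsAutMatrix b M M') :
    ∃ f : (R ⊗[k] C) ≃ₗc[R] (R ⊗[k] C), coeffMatrix b (f : R ⊗[k] C →ₗ[R] R ⊗[k] C) = M ∧
      coeffMatrix b (f.symm : R ⊗[k] C →ₗ[R] R ⊗[k] C) = M' := by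
  obtain ⟨f, rfl⟩ := exists_coeffMatrix_eq b M
  obtain ⟨f', rfl⟩ := exists_coeffMatrix_eq b M'
  have h1 : f' ∘ₗ f = LinearMap.id := linearMap_ext_coeffMatrix b (by
    rw [coeffMatrix_comp, coeffMatrix_id, h.mul_inv])
  have h2 : f ∘ₗ f' = LinearMap.id := linearMap_ext_coeffMatrix b (by
    rw [coeffMatrix_comp, coeffMatrix_id, h.inv_mul])
  exact ⟨{ toLinearMap := f
           counit_comp := (counit_iff_coeffMatrix b f).2 h.counit
           map_comp_comul := (comul_iff_coeffMatrix b f).2 h.comul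
           invFun := f'
           left_inv := LinearMap.congr_fun h1
           right_inv := LinearMap.congr_fun h2 }, rfl, rfl⟩

theorem coeffMatrix_baseChange {R S : Type u} [CommRing R] [Algebra k R] [CommRing S] [Algebra k S]
    (φ : R →ₐ[k] S) (f : (R ⊗[k] C) ≃ₗc[R] (R ⊗[k] C)) :
    coeffMatrix b (baseChange φ f : S ⊗[k] C →ₗ[S] S ⊗[k] C) =
      (coeffMatrix b (f : R ⊗[k] C →ₗ[R] R ⊗[k] C)).map φ := by
  ext p q
  have h := baseChange_scalarExt φ f (1 ⊗ₜ b p)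
  rw [scalarExt_tmul, map_one] at h
  change (b.baseChange S).repr (baseChange φ f (1 ⊗ₜ b p)) q = _
  rw [h, repr_scalarExt]
  rfl

theorem coeffMatrix_baseChange_symm {R S : Type u} [CommRing R] [Algebra k R] [CommRing S]
    [Algebra k S] (φ : R →ₐ[k] S) (f : (R ⊗[k] C) ≃ₗc[R] (R ⊗[k] C)) :
    coeffMatrix b ((baseChange φ f).symm : S ⊗[k] C →ₗ[S] S ⊗[k] C) =
      (coeffMatrix b (f.symm : R ⊗[k] C →ₗ[R] R ⊗[k] C)).map φ :=
  coeffMatrix_baseChange b φ f.symm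

/-- The automorphism group of a finite-dimensional coalgebra is a linear algebraic group, of
dimension the Krull dimension of `AutCoordRing`. -/
theorem isLinearAlgebraicGroupOfDim_coalgAutFunctor {d : ℕ}
    (hd : ringKrullDim (AutCoordRing b) = d) :
    IsLinearAlgebraicGroupOfDim (coalgAutFunctor k C) d := by
  obtain ⟨U, hU, hU'⟩ := (isAutMatrix_univ b).exists_coalgEquiv
  have hbij : ∀ R : CommAlgCat.{u} k, Function.Bijective
      fun φ : CommAlgCat.of k (AutCoordRing b) ⟶ R => baseChange φ.hom U := by
    intro R
    constructor
    · intro φ ψ h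
      refine CommAlgCat.hom_ext (autCoordRing_hom_ext b ?_ ?_)
      · have := congrArg (fun f : (R ⊗[k] C) ≃ₗc[R] (R ⊗[k] C) =>
          coeffMatrix b (f : R ⊗[k] C →ₗ[R] R ⊗[k] C)) h
        rw [← hU]
        exact (coeffMatrix_baseChange b _ U).symm.trans
          (this.trans (coeffMatrix_baseChange b _ U))
      · have := congrArg (fun f : (R ⊗[k] C) ≃ₗc[R] (R ⊗[k] C) =>
          coeffMatrix b (f.symm : R ⊗[k] C →ₗ[R] R ⊗[k] C)) h
        rw [← hU']
        exact (coeffMatrix_baseChange_symm b _ U).symm.trans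
          (this.trans (coeffMatrix_baseChange_symm b _ U))
    · intro f
      obtain ⟨φ, h1, -⟩ := (isAutMatrix_coeffMatrix b f).exists_hom
      refine ⟨CommAlgCat.ofHom φ, ?_⟩
      have : (baseChange φ U : R ⊗[k] C →ₗ[R] R ⊗[k] C) = (f : R ⊗[k] C →ₗ[R] R ⊗[k] C) :=
        linearMap_ext_coeffMatrix b (by rw [coeffMatrix_baseChange, hU, h1])
      exact CoalgEquiv.ext fun x => LinearMap.congr_fun this x
  refine ⟨CommAlgCat.of k (AutCoordRing b), ?_, ⟨⟨fun {R} => Equiv.ofBijective _ (hbij R), ?_⟩⟩, hd⟩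
  · exact Algebra.FiniteType.of_surjective (Ideal.Quotient.mkₐ k _)
      (Ideal.Quotient.mkₐ_surjective _ _)
  · intro R S g φ
    have := congrArg (fun h => h.hom U) ((coalgAutFunctor k C).map_comp φ g)
    exact this

end Representability

/-! ### Automorphisms of a coalgebra and of its dual algebra -/

section Transposition

open WithConv

variable {k : Type*} [Field k] {C : Type*} [AddCommGroup C] [Module k C]
  {m : ℕ} (b : Module.Basis (Fin m) k C) {R : Type*} [CommRing R] [Algebra k R]

variable (k C R) in
/-- The algebra of `R`-valued linear forms on the coalgebra `C`, with the convolution product: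
the dual of the `R`-coalgebra `R ⊗ C`. -/
abbrev ConvDual := WithConv (C →ₗ[k] R)

theorem convDual_ext {f g : ConvDual k C R} (h : ∀ p, f (b p) = g (b p)) : f = g :=
  WithConv.ext (b.ext h)

variable (R) in
/-- The linear form that reads off the coordinate with index `q`. -/
def coordForm (q : Fin m) : ConvDual k C R := toConv (Algebra.linearMap k R ∘ₗ b.coord q)

theorem coordForm_apply (p q : Fin m) : coordForm b R q (b p) = if p = q then 1 else 0 := by
  simp [coordForm, Finsupp.single_apply]

theorem convDual_sum_apply {ι : Type*} (s : Finset ι) (f : ι → ConvDual k C R) (c : C) :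
    (∑ i ∈ s, f i) c = ∑ i ∈ s, f i c := by
  rw [WithConv.ofConv_sum, LinearMap.sum_apply]

theorem convDual_smul_apply (a : R) (f : ConvDual k C R) (c : C) : (a • f) c = a * f c := rfl

theorem eq_sum_coordForm (f : ConvDual k C R) : f = ∑ q, f (b q) • coordForm b R q :=
  convDual_ext b fun p => by
    rw [convDual_sum_apply]
    simp only [convDual_smul_apply, coordForm_apply]
    simp

variable [Coalgebra k C]

theorem convDual_mul_apply (f g : ConvDual k C R) (p : Fin m) :
    (f * g) (b p) = ∑ q, ∑ r, algebraMap k R (structConst b p q r) * (f (b q) * g (b r)) := by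
  rw [LinearMap.convMul_apply, comul_eq_sum_structConst]
  simp [Algebra.smul_def, mul_assoc]

variable {b} in
/-- An automorphism of the coalgebra `R ⊗ C` acts on the dual algebra by transposition. -/
theorem IsAutMatrix.exists_algEquiv {M M' : Matrix (Fin m) (Fin m) R} (h : IsAutMatrix b M M') :
    ∃ φ : ConvDual k C R ≃ₐ[R] ConvDual k C R, ∀ f p, φ f (b p) = ∑ q, M p q * f (b q) := by
  let Φ (N : Matrix (Fin m) (Fin m) R) : ConvDual k C R →ₗ[R] ConvDual k C R :=
    { toFun := fun f => toConv (b.constr k fun p => ∑ q, N p q * f (b q))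
      map_add' := fun f g => convDual_ext b fun p => by
        change (b.constr k _ : C →ₗ[k] R) (b p) =
          (b.constr k _ : C →ₗ[k] R) (b p) + (b.constr k _ : C →ₗ[k] R) (b p)
        simp only [Module.Basis.constr_basis, ← Finset.sum_add_distrib, ← mul_add]
        rfl
      map_smul' := fun a f => convDual_ext b fun p => by
        change (b.constr k _ : C →ₗ[k] R) (b p) = a * (b.constr k _ : C →ₗ[k] R) (b p)
        simp only [Module.Basis.constr_basis, Finset.mul_sum]
        refine Finset.sum_congr rfl fun q _ => ?_
        rw [convDual_smul_apply, mul_left_comm] }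
  have hΦ : ∀ N f p, Φ N f (b p) = ∑ q, N p q * f (b q) := fun N f p =>
    b.constr_basis k (fun p => ∑ q, N p q * f (b q)) p
  have hcomp : ∀ N N', N * N' = 1 → ∀ f, Φ N (Φ N' f) = f := fun N N' hN f =>
    convDual_ext b fun p => by
      rw [hΦ]
      simp only [hΦ, Finset.mul_sum]
      rw [Finset.sum_comm]
      simp only [← mul_assoc, ← Finset.sum_mul, ← Matrix.mul_apply, hN]
      simp [Matrix.one_apply]
  have hone : Φ M 1 = 1 := convDual_ext b fun p => by
    rw [hΦ]
    exact h.counit p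
  have hmul : ∀ f g, Φ M (f * g) = Φ M f * Φ M g := fun f g => convDual_ext b fun p => by
    rw [hΦ, convDual_mul_apply]
    simp only [convDual_mul_apply, hΦ]
    calc ∑ s, M p s * ∑ q, ∑ r, algebraMap k R (structConst b s q r) * (f (b q) * g (b r))
        = ∑ q, ∑ r, (∑ s, M p s * algebraMap k R (structConst b s q r)) *
            (f (b q) * g (b r)) := by
          simp only [Finset.mul_sum, Finset.sum_mul]
          rw [Finset.sum_comm]
          refine Finset.sum_congr rfl fun q _ => ?_
          rw [Finset.sum_comm]
          simp only [mul_assoc]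
      _ = ∑ q, ∑ r, ∑ q', ∑ r', algebraMap k R (structConst b p q' r') *
            ((M q' q * f (b q)) * (M r' r * g (b r))) := by
          simp only [h.comul, Finset.sum_mul]
          refine Finset.sum_congr rfl fun q _ => Finset.sum_congr rfl fun r _ =>
            Finset.sum_congr rfl fun q' _ => Finset.sum_congr rfl fun r' _ => by ring
      _ = _ := by
          rw [Finset.sum_comm_cycle]
          refine Finset.sum_congr rfl fun q' _ => ?_
          rw [Finset.sum_comm_cycle]
          refine Finset.sum_congr rfl fun r' _ => ?_
          rw [Finset.sum_mul_sum]
          simp only [Finset.mul_sum]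
  refine ⟨AlgEquiv.ofLinearEquiv (LinearEquiv.ofLinearMap (Φ M) (Φ M')
    (LinearMap.ext (hcomp M M' h.mul_inv)) (LinearMap.ext (hcomp M' M h.inv_mul))) hone hmul, ?_⟩
  exact hΦ M

/-- An endomorphism of the dual algebra comes from an endomorphism of the coalgebra. -/
theorem isCoalgMatrix_of_algHom (φ : ConvDual k C R →ₐ[R] ConvDual k C R)
    {M : Matrix (Fin m) (Fin m) R} (hM : ∀ p q, M p q = φ (coordForm b R q) (b p)) :
    IsCoalgMatrix b M where
  comul p q r := by
    have h1 : coordForm b R q * coordForm b R r =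
        ∑ s, algebraMap k R (structConst b s q r) • coordForm b R s := by
      conv_lhs => rw [eq_sum_coordForm b (coordForm b R q * coordForm b R r)]
      refine Finset.sum_congr rfl fun s _ => ?_
      congr 1
      rw [convDual_mul_apply]
      simp [coordForm_apply]
    have h2 := congrArg (fun f : ConvDual k C R => f (b p)) (congrArg φ h1)
    simp only [map_mul, map_sum, map_smul, convDual_mul_apply, convDual_sum_apply,
      convDual_smul_apply, ← hM] at h2
    rw [h2]
    exact Finset.sum_congr rfl fun s _ => mul_comm _ _
  counit p := by
    have h1 := congrArg (fun f : ConvDual k C R => φ f (b p))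
      (eq_sum_coordForm b (1 : ConvDual k C R))
    simp only [map_one, map_sum, map_smul, convDual_sum_apply, convDual_smul_apply, ← hM] at h1
    refine Eq.trans (Finset.sum_congr rfl fun s _ => mul_comm _ _) h1.symm

end Transposition

end CoalgAut

/-! ### The truncated path algebra -/

/-- The truncated path algebra over `R`, realised as the dual algebra of the path coalgebra: an
element is determined by its coefficients `f (ofPath k N p)` at the paths `p` of length at most
`N`. -/
abbrev PathAlg (k : Type*) [Field k] (V : Type*) [Quiver V] (N : ℕ∞) (R : Type*) [CommRing R]
    [Algebra k R] :=
  CoalgAut.ConvDual k (PathCoalgebra k V N) R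

namespace PathAlg

open PathCoalgebra CoalgAut WithConv

section Basic

variable {k : Type*} [Field k] {V : Type*} [Quiver V] {N : ℕ∞} {R : Type*} [CommRing R]
  [Algebra k R]

theorem ofPath_eq_zero {a b : V} {p : Quiver.Path a b} (h : ¬ (p.length : ℕ∞) ≤ N) :
    ofPath k N p = 0 := dif_neg h

theorem ext {f g : PathAlg k V N R}
    (h : ∀ (a b : V) (p : Quiver.Path a b), (p.length : ℕ∞) ≤ N →
      f (ofPath k N p) = g (ofPath k N p)) :
    f = g :=
  WithConv.ext ((basis k V N).ext fun p => by
    rw [basis_eq_ofPath]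
    exact h _ _ _ p.length_le)

theorem mul_ofPath (f g : PathAlg k V N R) {a b : V} (p : Quiver.Path a b)
    (h : (p.length : ℕ∞) ≤ N) :
    (f * g) (ofPath k N p) =
      ((splits p).map fun x => f (ofPath k N x.2.1) * g (ofPath k N x.2.2)).sum := by
  rw [LinearMap.convMul_apply, comul_ofPath k N p h, map_list_sum, map_list_sum, List.map_map,
    List.map_map]
  rfl

theorem one_ofPath {a b : V} (p : Quiver.Path a b) (h : (p.length : ℕ∞) ≤ N) :
    (1 : PathAlg k V N R) (ofPath k N p) = if p.length = 0 then 1 else 0 := by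
  rw [LinearMap.convOne_apply, counit_ofPath k N p h]
  split_ifs <;> simp

theorem add_apply (f g : PathAlg k V N R) (c : PathCoalgebra k V N) : (f + g) c = f c + g c := rfl

theorem sub_apply (f g : PathAlg k V N R) (c : PathCoalgebra k V N) : (f - g) c = f c - g c := rfl

theorem smul_apply (r : R) (f : PathAlg k V N R) (c : PathCoalgebra k V N) :
    (r • f) c = r * f c := rfl

/-- The element with prescribed coefficients. -/
def ofFun (F : ∀ a b : V, Quiver.Path a b → R) : PathAlg k V N R :=
  toConv ((basis k V N).constr k fun p => F p.src p.tgt p.path)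

theorem ofFun_apply (F : ∀ a b : V, Quiver.Path a b → R) {a b : V} (p : Quiver.Path a b)
    (h : (p.length : ℕ∞) ≤ N) : (ofFun F : PathAlg k V N R) (ofPath k N p) = F a b p := by
  rw [ofPath, dif_pos h]
  exact (basis k V N).constr_basis k _ _

open Classical in
/-- The path `p` as an element of the path algebra (zero if `p` is longer than `N`). -/
def single {a b : V} (p : Quiver.Path a b) : PathAlg k V N R :=
  ofFun fun a' b' q => if (⟨a', b', q⟩ : Σ a b : V, Quiver.Path a b) = ⟨a, b, p⟩ then 1 else 0

open Classical in
theorem single_apply {a b : V} (p : Quiver.Path a b) {a' b' : V} (q : Quiver.Path a' b')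
    (h : (q.length : ℕ∞) ≤ N) : (single p : PathAlg k V N R) (ofPath k N q) =
      if (⟨a', b', q⟩ : Σ a b : V, Quiver.Path a b) = ⟨a, b, p⟩ then 1 else 0 :=
  ofFun_apply _ _ h

theorem single_apply_self {a b : V} (p : Quiver.Path a b) (h : (p.length : ℕ∞) ≤ N) :
    (single p : PathAlg k V N R) (ofPath k N p) = 1 := by
  rw [single_apply p p h, if_pos rfl]

theorem single_apply_eq_zero {a b : V} {p : Quiver.Path a b} {a' b' : V} {q : Quiver.Path a' b'}
    (h : q.length ≠ p.length) : (single p : PathAlg k V N R) (ofPath k N q) = 0 := by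
  by_cases hq : (q.length : ℕ∞) ≤ N
  · rw [single_apply p q hq, if_neg]
    intro heq
    cases heq
    exact h rfl
  · rw [ofPath_eq_zero hq, map_zero]

theorem nil_length_le (a : V) : ((Quiver.Path.nil : Quiver.Path a a).length : ℕ∞) ≤ N := by simp

theorem single_nil_mul_apply (i : V) (f : PathAlg k V N R) {a b : V} (p : Quiver.Path a b)
    [Decidable (a = i)] :
    ((single (.nil : Quiver.Path i i) : PathAlg k V N R) * f) (ofPath k N p) =
      if a = i then f (ofPath k N p) else 0 := by
  by_cases h : (p.length : ℕ∞) ≤ N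
  · rw [mul_ofPath _ _ p h]
    refine (sum_splits_left p (fun _ q r => (single (.nil : Quiver.Path i i) : PathAlg k V N R)
      (ofPath k N q) * f (ofPath k N r)) ?_).trans ?_
    · intro c q r hq
      rw [single_apply_eq_zero (by simpa using hq), zero_mul]
    · rw [single_apply _ _ (nil_length_le a)]
      by_cases hai : a = i
      · subst hai
        simp
      · rw [if_neg, if_neg hai, zero_mul]
        intro heq
        cases heq
        exact hai rfl
  · simp [ofPath_eq_zero h]

theorem mul_single_nil_apply (i : V) (f : PathAlg k V N R) {a b : V} (p : Quiver.Path a b)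
    [Decidable (b = i)] :
    (f * (single (.nil : Quiver.Path i i) : PathAlg k V N R)) (ofPath k N p) =
      if b = i then f (ofPath k N p) else 0 := by
  by_cases h : (p.length : ℕ∞) ≤ N
  · rw [mul_ofPath _ _ p h]
    refine (sum_splits_right p (fun _ q r => f (ofPath k N q) *
      (single (.nil : Quiver.Path i i) : PathAlg k V N R) (ofPath k N r)) ?_).trans ?_
    · intro c q r hr
      rw [single_apply_eq_zero (by simpa using hr), mul_zero]
    · rw [single_apply _ _ (nil_length_le b)]
      by_cases hbi : b = i
      · subst hbi
        simp
      · rw [if_neg, if_neg hbi, mul_zero]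
        intro heq
        cases heq
        exact hbi rfl
  · simp [ofPath_eq_zero h]

/-- Appending an arrow is multiplication by that arrow. -/
theorem single_cons {a b c : V} (p : Quiver.Path a b) (e : b ⟶ c) :
    (single (p.cons e) : PathAlg k V N R) = single p * single e.toPath := by
  refine ext fun a' c' q hq => ?_
  rw [mul_ofPath _ _ q hq, single_apply _ q hq]
  cases q with
  | nil =>
    rw [if_neg (by intro heq; cases heq)]
    simp only [splits, List.map_cons, List.map_nil, List.sum_cons, List.sum_nil, add_zero]
    rw [single_apply_eq_zero (p := e.toPath) (by simp), mul_zero]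
  | @cons b' _ q e' =>
    have hq' : (q.length : ℕ∞) ≤ N :=
      le_trans (by exact_mod_cast (by simp : q.length ≤ (q.cons e').length)) hq
    have h1 : (1 : ℕ∞) ≤ N :=
      le_trans (by exact_mod_cast (by simp : 1 ≤ (q.cons e').length)) hq
    simp only [splits, List.map_append, List.map_map, List.sum_append, Function.comp_def,
      List.map_cons, List.map_nil, List.sum_cons, List.sum_nil, add_zero]
    rw [single_apply_eq_zero (p := e.toPath) (q := (Quiver.Path.nil : Quiver.Path c' c')) (by simp),
      mul_zero, add_zero]
    -- only the splitting off of the last arrow contributes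
    refine Eq.trans ?_ (sum_splits_right q (fun d r s => (single p : PathAlg k V N R)
      (ofPath k N r) * (single e.toPath : PathAlg k V N R) (ofPath k N (s.cons e'))) ?_).symm
    · rw [single_apply p q hq', single_apply e.toPath _ (by simpa using h1)]
      by_cases heq : (⟨a', c', q.cons e'⟩ : Σ a b : V, Quiver.Path a b) = ⟨a, c, p.cons e⟩
      · cases heq
        rw [if_pos rfl, if_pos rfl, one_mul]
        exact (if_pos rfl).symm
      · rw [if_neg heq]
        by_cases h2 : (⟨a', b', q⟩ : Σ a b : V, Quiver.Path a b) = ⟨a, b, p⟩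
        · cases h2
          rw [if_pos rfl, if_neg, mul_zero]
          intro h3
          cases h3
          exact heq rfl
        · rw [if_neg h2, zero_mul]
    · intro d r s hs
      rw [single_apply_eq_zero (p := e.toPath) (by simpa using hs), mul_zero]

theorem single_nil_mul_single {i a b : V} (p : Quiver.Path a b) [Decidable (a = i)] :
    (single (.nil : Quiver.Path i i) : PathAlg k V N R) * single p =
      if a = i then single p else 0 := by
  classical
  refine ext fun a' b' q hq => ?_
  rw [single_nil_mul_apply]
  by_cases h : (⟨a', b', q⟩ : Σ a b : V, Quiver.Path a b) = ⟨a, b, p⟩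
  · cases h
    split_ifs <;> rfl
  · have h0 : (single p : PathAlg k V N R) (ofPath k N q) = 0 := by
      rw [single_apply p q hq, if_neg h]
    split_ifs <;> first | rfl | exact h0 | exact h0.symm

theorem single_mul_single_nil {i a b : V} (p : Quiver.Path a b) [Decidable (b = i)] :
    (single p : PathAlg k V N R) * single (.nil : Quiver.Path i i) =
      if b = i then single p else 0 := by
  classical
  refine ext fun a' b' q hq => ?_
  rw [mul_single_nil_apply]
  by_cases h : (⟨a', b', q⟩ : Σ a b : V, Quiver.Path a b) = ⟨a, b, p⟩
  · cases h
    split_ifs <;> rfl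
  · have h0 : (single p : PathAlg k V N R) (ofPath k N q) = 0 := by
      rw [single_apply p q hq, if_neg h]
    split_ifs <;> first | rfl | exact h0 | exact h0.symm

theorem sum_single_nil [Fintype V] :
    ∑ i : V, (single (.nil : Quiver.Path i i) : PathAlg k V N R) = 1 := by
  classical
  refine ext fun a b p h => ?_
  rw [convDual_sum_apply, one_ofPath p h]
  have h1 : ∀ i, (single (.nil : Quiver.Path i i) : PathAlg k V N R) (ofPath k N p) =
      if a = i then (if p.length = 0 then 1 else 0) else 0 := fun i => by
    rw [← one_ofPath (k := k) (N := N) p h, ← single_nil_mul_apply, mul_one]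
  simp [h1]

theorem eq_sum_single [Fintype (PathUpTo V N)] (f : PathAlg k V N R) :
    f = ∑ p : PathUpTo V N, f (ofPath k N p.path) • single p.path := by
  classical
  refine ext fun a b q h => ?_
  rw [convDual_sum_apply, Finset.sum_eq_single (⟨a, b, q, h⟩ : PathUpTo V N)]
  · rw [smul_apply, single_apply_self q h, mul_one]
  · intro p _ hp
    rw [smul_apply, single_apply _ q h, if_neg, mul_zero]
    rintro heq
    apply hp
    rcases p with ⟨a', b', p, hp'⟩
    cases heq
    rfl
  · simp

/-! ### The radical filtration -/

/-- The elements supported on paths of length at least `n`; for `n = 1` this is the arrow ideal. -/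
def fil (k : Type*) [Field k] (V : Type*) [Quiver V] (N : ℕ∞) (R : Type*) [CommRing R]
    [Algebra k R] (n : ℕ) : Submodule R (PathAlg k V N R) where
  carrier := {f | ∀ (a b : V) (p : Quiver.Path a b), p.length < n → f (ofPath k N p) = 0}
  add_mem' hf hg a b p h := by rw [add_apply, hf a b p h, hg a b p h, add_zero]
  zero_mem' _ _ _ _ := rfl
  smul_mem' r f hf a b p h := by rw [smul_apply, hf a b p h, mul_zero]

theorem mem_fil_one {f : PathAlg k V N R} :
    f ∈ fil k V N R 1 ↔ ∀ i : V, f (ofPath k N (.nil : Quiver.Path i i)) = 0 := by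
  constructor
  · intro h i
    exact h i i .nil (by simp)
  · intro h a b p hp
    cases p with
    | nil => exact h a
    | cons p e => simp at hp

theorem mul_mem_fil {m n : ℕ} {f g : PathAlg k V N R} (hf : f ∈ fil k V N R m)
    (hg : g ∈ fil k V N R n) : f * g ∈ fil k V N R (m + n) := by
  intro a b p hp
  by_cases h : (p.length : ℕ∞) ≤ N
  · rw [mul_ofPath _ _ p h]
    refine List.sum_eq_zero fun y hy => ?_
    obtain ⟨x, hx, rfl⟩ := List.mem_map.1 hy
    have := congrArg Quiver.Path.length (comp_of_mem_splits p x hx)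
    rw [Quiver.Path.length_comp] at this
    by_cases h1 : x.2.1.length < m
    · rw [hf _ _ _ h1, zero_mul]
    · rw [hg _ _ _ (by omega), mul_zero]
  · rw [ofPath_eq_zero h, map_zero]

theorem mem_fil_zero (f : PathAlg k V N R) : f ∈ fil k V N R 0 := fun _ _ _ h => by simp at h

theorem mul_mem_fil_left {n : ℕ} (f : PathAlg k V N R) {g : PathAlg k V N R}
    (hg : g ∈ fil k V N R n) : f * g ∈ fil k V N R n := by
  simpa using mul_mem_fil (mem_fil_zero f) hg

theorem mul_mem_fil_right {n : ℕ} {f : PathAlg k V N R} (hf : f ∈ fil k V N R n)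
    (g : PathAlg k V N R) : f * g ∈ fil k V N R n := by
  simpa using mul_mem_fil hf (mem_fil_zero g)

theorem pow_mem_fil {f : PathAlg k V N R} (hf : f ∈ fil k V N R 1) (n : ℕ) :
    f ^ n ∈ fil k V N R n := by
  induction n with
  | zero => exact mem_fil_zero _
  | succ n ih =>
    rw [pow_succ]
    exact mul_mem_fil ih hf

theorem eq_zero_of_mem_fil {n : ℕ} (h : N < n) {f : PathAlg k V N R} (hf : f ∈ fil k V N R n) :
    f = 0 :=
  ext fun a b p hp => hf a b p (by exact_mod_cast hp.trans_lt h)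

theorem exists_fil_eq_zero [Finite (PathUpTo V N)] :
    ∃ n : ℕ, ∀ f ∈ fil k V N R n, f = 0 := by
  obtain ⟨n, hn⟩ := (Set.finite_range fun p : PathUpTo V N => p.path.length).bddAbove
  refine ⟨n + 1, fun f hf => ext fun a b p hp => hf a b p (Nat.lt_succ_of_le ?_)⟩
  exact hn ⟨⟨a, b, p, hp⟩, rfl⟩

theorem isNilpotent_of_mem_fil_one [Finite (PathUpTo V N)] {f : PathAlg k V N R}
    (hf : f ∈ fil k V N R 1) : IsNilpotent f := by
  obtain ⟨n, hn⟩ := exists_fil_eq_zero (k := k) (V := V) (N := N) (R := R)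
  exact ⟨n, hn _ (pow_mem_fil hf n)⟩

theorem single_mem_fil {a b : V} (p : Quiver.Path a b) :
    (single p : PathAlg k V N R) ∈ fil k V N R p.length := by
  exact fun a' b' q hq => single_apply_eq_zero hq.ne

variable (k V N R) in
/-- Evaluation at a vertex, an algebra homomorphism. -/
def evalVertex (i : V) : PathAlg k V N R →ₐ[R] R where
  toFun f := f (ofPath k N (.nil : Quiver.Path i i))
  map_one' := by rw [one_ofPath _ (nil_length_le i)]; simp
  map_mul' f g := by rw [mul_ofPath _ _ _ (nil_length_le i)]; simp [splits]
  map_zero' := rfl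
  map_add' _ _ := rfl
  commutes' r := by
    rw [Algebra.algebraMap_eq_smul_one, smul_apply, one_ofPath _ (nil_length_le i)]; simp

theorem mem_fil_one_of_isNilpotent [IsReduced R] {f : PathAlg k V N R} (hf : IsNilpotent f) :
    f ∈ fil k V N R 1 :=
  mem_fil_one.2 fun i => (hf.map (evalVertex k V N R i)).eq_zero

/-! ### Elements with coefficients in a subalgebra -/

/-- The elements all of whose coefficients lie in the subalgebra `S`. -/
def coeffsIn (S : Subalgebra k R) : Subring (PathAlg k V N R) where
  carrier := {f | ∀ (a b : V) (p : Quiver.Path a b), f (ofPath k N p) ∈ S}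
  add_mem' hf hg a b p := S.add_mem (hf a b p) (hg a b p)
  zero_mem' _ _ _ := S.zero_mem
  neg_mem' hf a b p := S.neg_mem (hf a b p)
  one_mem' a b p := by
    by_cases h : (p.length : ℕ∞) ≤ N
    · rw [one_ofPath p h]
      split_ifs
      exacts [S.one_mem, S.zero_mem]
    · rw [ofPath_eq_zero h, map_zero]
      exact S.zero_mem
  mul_mem' {f g} hf hg a b p := by
    by_cases h : (p.length : ℕ∞) ≤ N
    · rw [mul_ofPath _ _ p h]
      refine list_sum_mem fun y hy => ?_
      obtain ⟨x, -, rfl⟩ := List.mem_map.1 hy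
      exact S.mul_mem (hf _ _ _) (hg _ _ _)
    · rw [ofPath_eq_zero h, map_zero]
      exact S.zero_mem

theorem single_mem_coeffsIn (S : Subalgebra k R) {a b : V} (p : Quiver.Path a b) :
    (single p : PathAlg k V N R) ∈ coeffsIn S := by
  intro a' b' q
  by_cases h : (q.length : ℕ∞) ≤ N
  · rw [single_apply p q h]
    split_ifs
    exacts [S.one_mem, S.zero_mem]
  · rw [ofPath_eq_zero h, map_zero]
    exact S.zero_mem

/-- Unipotent elements are invertible, with the same coefficient ring. -/
theorem exists_inverse [Finite (PathUpTo V N)] {f : PathAlg k V N R} (hf : f - 1 ∈ fil k V N R 1) :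
    ∃ g : PathAlg k V N R, g - 1 ∈ fil k V N R 1 ∧ f * g = 1 ∧ g * f = 1 ∧
      ∀ S : Subalgebra k R, f ∈ coeffsIn S → g ∈ coeffsIn S := by
  obtain ⟨n, hn⟩ := isNilpotent_of_mem_fil_one hf
  -- the inverse is a finite geometric series in `1 - f`
  have hn' : (1 - f) ^ n = 0 := by rw [← neg_sub, neg_pow, hn, mul_zero]
  have h1 := mul_neg_geom_sum (1 - f) n
  have h2 := geom_sum_mul_neg (1 - f) n
  rw [hn', sub_zero, sub_sub_cancel] at h1 h2
  refine ⟨∑ i ∈ Finset.range n, (1 - f) ^ i, ?_, h1, h2, fun S hS => ?_⟩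
  · have h3 : (∑ i ∈ Finset.range n, (1 - f) ^ i) - 1 =
        -((∑ i ∈ Finset.range n, (1 - f) ^ i) * (f - 1)) := by
      rw [mul_sub, h2]; simp
    rw [h3]
    exact Submodule.neg_mem _ (mul_mem_fil_left _ hf)
  · exact sum_mem fun i _ => pow_mem (sub_mem (one_mem _) hS) i

end Basic

section Vertices

variable {k : Type*} [Field k] {V : Type*} [Quiver V] {N : ℕ∞} {R : Type*} [CommRing R]
  [Algebra k R]

/-! ### Vertex idempotents and conjugation -/

/-- The idempotent of a vertex. -/
abbrev vertex (i : V) : PathAlg k V N R := single (.nil : Quiver.Path i i)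

theorem vertex_mul_vertex (i j : V) [Decidable (i = j)] :
    (vertex i * vertex j : PathAlg k V N R) = if i = j then vertex i else 0 := by
  rw [single_mul_single_nil]

theorem vertex_mul_self (i : V) : (vertex i * vertex i : PathAlg k V N R) = vertex i := by
  classical
  rw [vertex_mul_vertex, if_pos rfl]

theorem single_mul_vertex {a b : V} (p : Quiver.Path a b) :
    (single p * vertex b : PathAlg k V N R) = single p := by
  classical
  rw [single_mul_single_nil, if_pos rfl]

theorem vertex_mul_single {a b : V} (p : Quiver.Path a b) :
    (vertex a * single p : PathAlg k V N R) = single p := by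
  classical
  rw [single_nil_mul_single, if_pos rfl]

theorem evalVertex_vertex (i j : V) [Decidable (i = j)] :
    evalVertex k V N R j (vertex i) = if i = j then 1 else 0 := by
  classical
  change (single _ : PathAlg k V N R) _ = _
  rw [single_apply _ _ (nil_length_le j)]
  split_ifs with h1 h2 h2
  · rfl
  · cases h1; exact absurd rfl h2
  · subst h2; exact absurd rfl h1
  · rfl

theorem evalVertex_eq_one {f : PathAlg k V N R} (hf : f - 1 ∈ fil k V N R 1) (i : V) :
    evalVertex k V N R i f = 1 := by
  have := mem_fil_one.1 hf i
  change evalVertex k V N R i (f - 1) = 0 at this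
  rwa [map_sub, map_one, sub_eq_zero] at this

theorem sub_one_mem_fil_iff {f : PathAlg k V N R} :
    f - 1 ∈ fil k V N R 1 ↔ ∀ i, evalVertex k V N R i f = 1 := by
  refine ⟨evalVertex_eq_one, fun h => mem_fil_one.2 fun i => ?_⟩
  change evalVertex k V N R i (f - 1) = 0
  rw [map_sub, map_one, h, sub_self]

variable [Fintype V]

/-- The block diagonal part `∑ i, e_i f e_i` of `f`: the part supported on closed paths. -/
def diagPart (f : PathAlg k V N R) : PathAlg k V N R := ∑ i, vertex i * f * vertex i

theorem diagPart_apply (f : PathAlg k V N R) {a b : V} (p : Quiver.Path a b) [Decidable (a = b)] :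
    diagPart f (ofPath k N p) = if a = b then f (ofPath k N p) else 0 := by
  classical
  rw [diagPart, convDual_sum_apply]
  simp only [mul_single_nil_apply, single_nil_mul_apply]
  simp

theorem vertex_mul_diagPart (i : V) (f : PathAlg k V N R) :
    vertex i * diagPart f = vertex i * f * vertex i := by
  classical
  simp only [diagPart, Finset.mul_sum, ← mul_assoc, vertex_mul_vertex]
  simp [ite_mul]

theorem diagPart_mul_vertex (i : V) (f : PathAlg k V N R) :
    diagPart f * vertex i = vertex i * f * vertex i := by
  classical
  simp only [diagPart, Finset.sum_mul, mul_assoc, vertex_mul_vertex]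
  simp [mul_ite]

theorem diagPart_mul (f : PathAlg k V N R) {d : PathAlg k V N R}
    (hd : ∀ i, vertex i * d = d * vertex i) : diagPart (f * d) = diagPart f * d := by
  simp only [diagPart, Finset.sum_mul]
  exact Finset.sum_congr rfl fun i _ => by simp only [mul_assoc, hd]

theorem diagPart_sub_one_mem_fil {f : PathAlg k V N R} (hf : f - 1 ∈ fil k V N R 1) :
    diagPart f - 1 ∈ fil k V N R 1 := by
  classical
  rw [sub_one_mem_fil_iff] at hf ⊢
  intro i
  rw [← hf i]
  exact (diagPart_apply f _).trans (if_pos rfl)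

theorem diagPart_mem_coeffsIn {S : Subalgebra k R} {f : PathAlg k V N R} (hf : f ∈ coeffsIn S) :
    diagPart f ∈ coeffsIn S :=
  sum_mem fun _ _ => mul_mem (mul_mem (single_mem_coeffsIn S _) hf) (single_mem_coeffsIn S _)

/-- Orthogonal idempotents `E i` lifting the vertices up to a permutation `σ` are conjugate to the
vertex idempotents. The conjugating element is normalised to have diagonal part `1`; this makes it
unique, see `conjugator_unique`. -/
theorem exists_conjugator [Finite (PathUpTo V N)] {E : V → PathAlg k V N R} {σ : Equiv.Perm V}
    (hE : ∀ i, E i * E i = E i) (hE' : ∀ i j, i ≠ j → E i * E j = 0)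
    (hσ : ∀ i j, evalVertex k V N R (σ j) (E i) = evalVertex k V N R j (vertex i)) :
    ∃ v : PathAlg k V N R, v - 1 ∈ fil k V N R 1 ∧ diagPart v = 1 ∧
      (∀ i, E i * v = v * vertex (σ i)) ∧
      ∀ S : Subalgebra k R, (∀ i, E i ∈ coeffsIn S) → v ∈ coeffsIn S := by
  classical
  -- `v'` intertwines both families; dividing by its diagonal part normalises it
  let v' : PathAlg k V N R := ∑ i, E i * vertex (σ i)
  have h1 : ∀ i, E i * v' = E i * vertex (σ i) := fun i => by
    simp only [v', Finset.mul_sum]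
    rw [Finset.sum_eq_single i, ← mul_assoc, hE]
    · intro j _ hj
      rw [← mul_assoc, hE' i j hj.symm, zero_mul]
    · simp
  have h2 : ∀ i, v' * vertex (σ i) = E i * vertex (σ i) := fun i => by
    simp only [v', Finset.sum_mul]
    rw [Finset.sum_eq_single i, mul_assoc, vertex_mul_self]
    · intro j _ hj
      rw [mul_assoc, vertex_mul_vertex, if_neg (fun h => hj (σ.injective h)), mul_zero]
    · simp
  have h3 : v' - 1 ∈ fil k V N R 1 := by
    rw [sub_one_mem_fil_iff]
    intro j
    obtain ⟨j, rfl⟩ := σ.surjective j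
    simp only [v', map_sum, map_mul, hσ, evalVertex_vertex]
    simp
  obtain ⟨d, hd1, hd2, hd3, hd4⟩ := exists_inverse (diagPart_sub_one_mem_fil h3)
  have hd : ∀ i, vertex i * d = d * vertex i := fun i => by
    calc vertex i * d = d * diagPart v' * (vertex i * d) := by rw [hd3, one_mul]
      _ = d * (vertex i * v' * vertex i) * d := by
        rw [← diagPart_mul_vertex]; simp only [mul_assoc]
      _ = d * vertex i * (diagPart v' * d) := by
        rw [← vertex_mul_diagPart]; simp only [mul_assoc]
      _ = d * vertex i := by rw [hd2, mul_one]
  refine ⟨v' * d, ?_, ?_, ?_, ?_⟩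
  · rw [sub_one_mem_fil_iff] at h3 hd1 ⊢
    intro i
    rw [map_mul, h3, hd1, one_mul]
  · rw [diagPart_mul _ hd, hd2]
  · intro i
    rw [← mul_assoc, h1, mul_assoc v', ← hd, ← mul_assoc, h2]
  · intro S hS
    have hv' : v' ∈ coeffsIn S :=
      sum_mem fun i _ => mul_mem (hS i) (single_mem_coeffsIn S _)
    exact mul_mem hv' (hd4 S (diagPart_mem_coeffsIn hv'))

/-- Two normalised conjugating elements differ by an element that commutes with the vertices, and
the normalisation forces it to be `1`. -/
theorem conjugator_unique {E : V → PathAlg k V N R} {σ : V → V} (hσ : Function.Surjective σ)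
    {v v' v₂ : PathAlg k V N R} (hv : v * v' = 1) (hv' : v' * v = 1)
    (hvE : ∀ i, E i * v = v * vertex (σ i)) (hvE₂ : ∀ i, E i * v₂ = v₂ * vertex (σ i))
    (hD : diagPart v = 1) (hD₂ : diagPart v₂ = 1) : v₂ = v := by
  have hc : ∀ i, vertex i * (v' * v₂) = v' * v₂ * vertex i := fun i => by
    obtain ⟨i, rfl⟩ := hσ i
    calc vertex (σ i) * (v' * v₂) = v' * (v * vertex (σ i)) * (v' * v₂) := by
          rw [← mul_assoc v', hv', one_mul]
      _ = v' * E i * (v * v') * v₂ := by rw [← hvE]; simp only [mul_assoc]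
      _ = v' * v₂ * vertex (σ i) := by rw [hv, mul_one, mul_assoc, hvE₂, mul_assoc]
  have h := diagPart_mul v hc
  rw [← mul_assoc, hv, one_mul, hD, hD₂, one_mul] at h
  rw [← one_mul v₂, ← hv, mul_assoc, ← h, mul_one]

end Vertices

/-- The nontrivial paths from `s` to `t` of length at most `N`. -/
abbrev RadPath {V : Type*} [Quiver V] (N : ℕ∞) (s t : V) :=
  {p : Quiver.Path s t // 1 ≤ p.length ∧ (p.length : ℕ∞) ≤ N}

instance {V : Type*} [Quiver V] (N : ℕ∞) [Finite (PathUpTo V N)] (s t : V) :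
    Finite (RadPath N s t) :=
  Finite.of_injective (fun p : RadPath N s t => (⟨s, t, p.1, p.2.2⟩ : PathUpTo V N))
    fun p q h => by
      simp only [PathUpTo.mk.injEq, heq_eq_eq, true_and] at h
      exact Subtype.ext h

/-! ### Automorphisms over a domain -/

section Conjugation

variable {k : Type*} [Field k] {V : Type*} [Quiver V] {N : ℕ∞} {K : Type*} [CommRing K]
  [Algebra k K] {φ : PathAlg k V N K ≃ₐ[K] PathAlg k V N K} {σ : V → V} {v v' : PathAlg k V N K}

/-- The conjugate of an automorphism that permutes the vertices maps `e_s f e_t` into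
`e_{σ s} A e_{σ t}`. -/
theorem conj_apply_eq_zero (h1 : v * v' = 1)
    (hv : ∀ i, v' * φ (vertex i) * v = vertex (σ i)) {s t : V} {f : PathAlg k V N K}
    (hs : vertex s * f = f) (ht : f * vertex t = f) {a b : V} (p : Quiver.Path a b)
    (hp : ¬ (a = σ s ∧ b = σ t)) : (v' * φ f * v) (ofPath k N p) = 0 := by
  classical
  have hl : vertex (σ s) * (v' * φ f * v) = v' * φ f * v := by
    calc vertex (σ s) * (v' * φ f * v) = v' * φ (vertex s) * (v * v') * φ f * v := by
          rw [← hv]; simp only [mul_assoc]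
      _ = v' * φ f * v := by rw [h1, mul_one, mul_assoc v', ← map_mul, hs]
  have hr : (v' * φ f * v) * vertex (σ t) = v' * φ f * v := by
    calc (v' * φ f * v) * vertex (σ t) = v' * φ f * (v * v') * φ (vertex t) * v := by
          rw [← hv]; simp only [mul_assoc]
      _ = v' * φ f * v := by rw [h1, mul_one, mul_assoc v', ← map_mul, ht]
  by_cases ha : a = σ s
  · rw [← hr, mul_single_nil_apply, if_neg fun hb => hp ⟨ha, hb⟩]
  · rw [← hl, single_nil_mul_apply, if_neg ha]

end Conjugation

section Domain

variable {k : Type*} [Field k] {V : Type*} [Quiver V] {N : ℕ∞}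
  [Finite (PathUpTo V N)] {K : Type*} [CommRing K] [IsDomain K] [Algebra k K]
  (φ : PathAlg k V N K ≃ₐ[K] PathAlg k V N K)

/-- Over a reduced ring the arrow ideal contains every nilpotent element, so it is preserved. -/
theorem algEquiv_mem_fil_one {f : PathAlg k V N K} (hf : f ∈ fil k V N K 1) :
    φ f ∈ fil k V N K 1 :=
  mem_fil_one_of_isNilpotent ((isNilpotent_of_mem_fil_one hf).map φ)

/-- The conjugate of `φ` embeds `e_s J e_t`, which has the basis `RadPath N s t`, into
`e_{σ s} J e_{σ t}`. -/
theorem card_radPath_le {σ : V → V} {v v' : PathAlg k V N K} (h1 : v * v' = 1)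
    (hv : ∀ i, v' * φ (vertex i) * v = vertex (σ i)) (s t : V) :
    Nat.card (RadPath N s t) ≤ Nat.card (RadPath N (σ s) (σ t)) := by
  classical
  have := Fintype.ofFinite (RadPath N s t)
  have := Fintype.ofFinite (RadPath N (σ s) (σ t))
  let L : (RadPath N s t → K) →ₗ[K] PathAlg k V N K :=
    Fintype.linearCombination K fun p : RadPath N s t => single p.1
  have hL : ∀ g, L g = ∑ p, g p • single p.1 := fun g => Fintype.linearCombination_apply K _ g
  have hLp : ∀ g p, L g (ofPath k N p.1) = g p := fun g p => by
    rw [hL, convDual_sum_apply, Finset.sum_eq_single p]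
    · rw [smul_apply, single_apply_self _ p.2.2, mul_one]
    · intro q _ hq
      rw [smul_apply, single_apply _ _ p.2.2, if_neg, mul_zero]
      intro heq
      apply hq
      simp only [Sigma.mk.injEq, heq_eq_eq, true_and] at heq
      exact Subtype.ext heq.symm
    · simp
  have hLs : ∀ g, vertex s * L g = L g := fun g => by
    simp only [hL, Finset.mul_sum, mul_smul_comm, vertex_mul_single]
  have hLt : ∀ g, L g * vertex t = L g := fun g => by
    simp only [hL, Finset.sum_mul, smul_mul_assoc, single_mul_vertex]
  have hLJ : ∀ g, L g ∈ fil k V N K 1 := fun g => by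
    rw [hL]
    refine Submodule.sum_mem _ fun p _ => Submodule.smul_mem _ _ ?_
    exact fun a b q hq => single_apply_eq_zero (by have := p.2.1; omega)
  let F : (RadPath N s t → K) →ₗ[K] (RadPath N (σ s) (σ t) → K) :=
    { toFun := fun g q => (v' * φ (L g) * v) (ofPath k N q.1)
      map_add' := fun g g' => by
        funext q
        simp only [map_add, mul_add, add_mul]
        rfl
      map_smul' := fun r g => by
        funext q
        simp only [map_smul, mul_smul_comm, smul_mul_assoc]
        rfl }
  have hF : Function.Injective F := by
    rw [injective_iff_map_eq_zero]
    intro g hg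
    have h0 : v' * φ (L g) * v = 0 := by
      refine ext fun a b p hp => ?_
      by_cases hab : a = σ s ∧ b = σ t
      · obtain ⟨rfl, rfl⟩ := hab
        by_cases hp1 : 1 ≤ p.length
        · exact congrFun hg ⟨p, hp1, hp⟩
        · exact mul_mem_fil_right (mul_mem_fil_left v' (algEquiv_mem_fil_one φ (hLJ g))) v _ _ p
            (by omega)
      · exact conj_apply_eq_zero h1 hv (hLs g) (hLt g) p hab
    have h3 : φ (L g) = 0 := by
      calc φ (L g) = v * (v' * φ (L g) * v) * v' := by
            simp only [← mul_assoc, h1, one_mul]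
            rw [mul_assoc, h1, mul_one]
        _ = 0 := by rw [h0, mul_zero, zero_mul]
    have h4 : L g = 0 := φ.injective (by rw [h3, map_zero])
    funext p
    exact (hLp g p).symm.trans (by rw [h4]; rfl)
  rw [Nat.card_eq_fintype_card, Nat.card_eq_fintype_card]
  exact card_le_of_injective K F hF

variable [Fintype V]

/-- Over a domain, an automorphism permutes the vertices modulo the arrow ideal. -/
theorem exists_vertexPerm : ∃ σ : Equiv.Perm V, ∀ i j,
    evalVertex k V N K (σ j) (φ (vertex i)) = evalVertex k V N K j (vertex i) := by
  classical
  let x : V → V → K := fun i j => evalVertex k V N K j (φ (vertex i))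
  have hx : ∀ i j, x i j = 0 ∨ x i j = 1 := fun i j => by
    have h : x i j * x i j = x i j := by
      simp only [x, ← map_mul, vertex_mul_self]
    have h' : x i j * (x i j - 1) = 0 := by rw [mul_sub, h, mul_one, sub_self]
    rcases mul_eq_zero.1 h' with h0 | h0
    · exact .inl h0
    · exact .inr (sub_eq_zero.1 h0)
  have horth : ∀ i i' j, i ≠ i' → x i j * x i' j = 0 := fun i i' j h => by
    simp only [x, ← map_mul, vertex_mul_vertex, if_neg h, map_zero]
  have hsum : ∀ j, ∑ i, x i j = 1 := fun j => by
    simp only [x, ← map_sum]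
    rw [sum_single_nil, map_one, map_one]
  have hex : ∀ j, ∃ i, x i j = 1 := fun j => by
    by_contra h
    push Not at h
    have : ∑ i, x i j = 0 := Finset.sum_eq_zero fun i _ => (hx i j).resolve_right (h i)
    rw [hsum] at this
    exact one_ne_zero this
  choose τ hτ using hex
  have hτ' : ∀ i j, x i j = if i = τ j then 1 else 0 := fun i j => by
    split_ifs with h
    · rw [h, hτ]
    · have := horth i (τ j) j h
      rwa [hτ, mul_one] at this
  -- a vertex outside the image of `τ` would be mapped to a nilpotent idempotent
  have hsurj : Function.Surjective τ := fun i => by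
    by_contra h
    push Not at h
    have h1 : φ (vertex i) ∈ fil k V N K 1 := mem_fil_one.2 fun j =>
      (hτ' i j).trans (if_neg (h j).symm)
    obtain ⟨n, hn⟩ := isNilpotent_of_mem_fil_one h1
    have h2 : IsIdempotentElem (φ (vertex i)) := by
      rw [IsIdempotentElem, ← map_mul, vertex_mul_self]
    have h3 : φ (vertex i) = 0 := by
      rw [← h2.pow_succ_eq n, pow_succ, hn, zero_mul]
    have h4 : (vertex i : PathAlg k V N K) = 0 := φ.injective (by rw [h3, map_zero])
    have h5 := evalVertex_vertex (k := k) (N := N) (R := K) i i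
    rw [h4, map_zero, if_pos rfl] at h5
    exact zero_ne_one h5
  let σ : Equiv.Perm V := (Equiv.ofBijective τ (Finite.surjective_iff_bijective.1 hsurj)).symm
  have hτσ : ∀ j, τ (σ j) = j :=
    (Equiv.ofBijective τ (Finite.surjective_iff_bijective.1 hsurj)).apply_symm_apply
  refine ⟨σ, fun i j => ?_⟩
  rw [evalVertex_vertex]
  change x i (σ j) = _
  rw [hτ', hτσ]

/-- The part of an automorphism that acts on the vertices is the composite of a permutation and a
conjugation. -/
theorem exists_perm_conjugator : ∃ (σ : Equiv.Perm V) (v v' : PathAlg k V N K),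
    v * v' = 1 ∧ v' * v = 1 ∧ diagPart v = 1 ∧
    (∀ i, v' * φ (vertex i) * v = vertex (σ i)) ∧
    ∀ S : Subalgebra k K, v ∈ coeffsIn S → v' ∈ coeffsIn S := by
  classical
  obtain ⟨σ, hσ⟩ := exists_vertexPerm φ
  obtain ⟨v, hv1, hv2, hv3, -⟩ := exists_conjugator (E := fun i => φ (vertex i)) (σ := σ)
    (fun i => by rw [← map_mul, vertex_mul_self])
    (fun i j h => by rw [← map_mul, vertex_mul_vertex, if_neg h, map_zero]) hσ
  obtain ⟨v', -, h1, h2, h3⟩ := exists_inverse hv1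
  exact ⟨σ, v, v', h1, h2, hv2, fun i => by rw [mul_assoc, hv3, ← mul_assoc, h2, one_mul], h3⟩

variable {φ} {σ : Equiv.Perm V} {v v' : PathAlg k V N K}

/-- The inequalities of `card_radPath_le` are equalities, as both sides have the same sum over all
pairs of vertices. -/
theorem card_radPath_eq (h1 : v * v' = 1)
    (hv : ∀ i, v' * φ (vertex i) * v = vertex (σ i)) (s t : V) :
    Nat.card (RadPath N s t) = Nat.card (RadPath N (σ s) (σ t)) := by
  have hle : ∀ x ∈ (Finset.univ : Finset (V × V)), Nat.card (RadPath N x.1 x.2) ≤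
      Nat.card (RadPath N (σ x.1) (σ x.2)) := fun x _ => card_radPath_le φ h1 hv x.1 x.2
  refine (Finset.sum_eq_sum_iff_of_le hle).1 ?_ (s, t) (Finset.mem_univ _)
  exact ((σ.prodCongr σ).sum_comp fun x : V × V => Nat.card (RadPath N x.1 x.2)).symm

/-- The index set for the coordinates of an automorphism with vertex permutation `σ`: an arrow
`a : s ⟶ t` contributes the coefficients of its image in `e_{σ s} J e_{σ t}`, where `J` is the
arrow ideal, and a pair `s ≠ t` contributes the coefficients of the conjugating element there. -/
abbrev CoordIndex (N : ℕ∞) {V : Type*} [Quiver V] (σ : V → V) :=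
  Σ s t : V, ((s ⟶ t) ⊕ PLift (s ≠ t)) × RadPath N (σ s) (σ t)

variable (φ) in
/-- Over a domain, the coefficients of an automorphism are polynomials in coordinates whose number
is the asserted dimension. -/
theorem exists_coordinates : ∃ (σ : Equiv.Perm V) (x : CoordIndex N σ → K),
    (∀ s t, Nat.card (RadPath N s t) = Nat.card (RadPath N (σ s) (σ t))) ∧
    ∀ (a b : V) (p : Quiver.Path a b),
      φ (single p) ∈ coeffsIn (Algebra.adjoin k (Set.range x)) := by
  classical
  obtain ⟨σ, v, v', h1, h2, hD, hv, hv'⟩ := exists_perm_conjugator φ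
  let x : CoordIndex N σ → K := fun i => match i with
    | ⟨_, _, .inl a, p⟩ => (v' * φ (single a.toPath) * v) (ofPath k N p.1)
    | ⟨_, _, .inr _, p⟩ => v (ofPath k N p.1)
  refine ⟨σ, x, card_radPath_eq h1 hv, ?_⟩
  set S := Algebra.adjoin k (Set.range x)
  have hxS : ∀ i, x i ∈ S := fun i => Algebra.subset_adjoin ⟨i, rfl⟩
  have hvS : v ∈ coeffsIn S := by
    intro a b p
    by_cases hp : (p.length : ℕ∞) ≤ N
    · by_cases hab : a = b
      · have h3 := diagPart_apply v p
        rw [if_pos hab, hD] at h3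
        rw [← h3]
        exact one_mem (coeffsIn (N := N) S) a b p
      · obtain ⟨s, rfl⟩ := σ.surjective a
        obtain ⟨t, rfl⟩ := σ.surjective b
        have hp1 : 1 ≤ p.length :=
          Nat.one_le_iff_ne_zero.2 fun h0 => hab (p.eq_of_length_zero h0)
        exact hxS ⟨s, t, .inr ⟨fun h => hab (congrArg σ h)⟩, ⟨p, hp1, hp⟩⟩
    · rw [ofPath_eq_zero hp, map_zero]
      exact S.zero_mem
  have hv'S := hv' S hvS
  have hconj : ∀ f, v' * φ f * v ∈ coeffsIn S → φ f ∈ coeffsIn S := fun f hf => by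
    have : φ f = v * (v' * φ f * v) * v' := by
      simp only [← mul_assoc, h1, one_mul]
      rw [mul_assoc, h1, mul_one]
    rw [this]
    exact mul_mem (mul_mem hvS hf) hv'S
  have harr : ∀ (s t : V) (a : s ⟶ t), φ (single a.toPath) ∈ coeffsIn S := fun s t a => by
    refine hconj _ fun c d p => ?_
    by_cases hp : (p.length : ℕ∞) ≤ N
    · by_cases hcd : c = σ s ∧ d = σ t
      · obtain ⟨rfl, rfl⟩ := hcd
        by_cases hp1 : 1 ≤ p.length
        · exact hxS ⟨s, t, .inl a, ⟨p, hp1, hp⟩⟩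
        · rw [mul_mem_fil_right (mul_mem_fil_left v' (algEquiv_mem_fil_one φ
            (single_mem_fil a.toPath))) v _ _ p (by simpa using hp1)]
          exact S.zero_mem
      · rw [conj_apply_eq_zero h1 hv (vertex_mul_single _) (single_mul_vertex _) p hcd]
        exact S.zero_mem
    · rw [ofPath_eq_zero hp, map_zero]
      exact S.zero_mem
  intro a b p
  induction p with
  | nil =>
    refine hconj _ ?_
    rw [hv]
    exact single_mem_coeffsIn S _
  | cons p e ih =>
    rw [single_cons, map_mul]
    exact mul_mem ih (harr _ _ e)

end Domain

/-! ### Endomorphisms from the images of the arrows -/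

section Substitution

variable {k : Type*} [Field k] {V : Type*} [Quiver V] {N : ℕ∞} {R : Type*} [CommRing R]
  [Algebra k R]

/-- The product of the elements `w a` along the arrows `a` of a path. -/
def pathProd (w : ∀ {s t : V}, (s ⟶ t) → PathAlg k V N R) {a : V} :
    ∀ {b : V}, Quiver.Path a b → PathAlg k V N R
  | _, .nil => vertex a
  | _, .cons p e => pathProd w p * w e

variable {w : ∀ {s t : V}, (s ⟶ t) → PathAlg k V N R}

theorem pathProd_mul_vertex (hw : ∀ {s t : V} (e : s ⟶ t), w e * vertex t = w e) {a b : V}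
    (p : Quiver.Path a b) : pathProd w p * vertex b = pathProd w p := by
  cases p with
  | nil => exact vertex_mul_self a
  | cons p e => rw [pathProd, mul_assoc, hw]

theorem pathProd_mem_fil (hw : ∀ {s t : V} (e : s ⟶ t), w e ∈ fil k V N R 1) {a b : V}
    (p : Quiver.Path a b) : pathProd w p ∈ fil k V N R p.length := by
  induction p with
  | nil => exact mem_fil_zero _
  | cons p e ih => exact mul_mem_fil ih (hw e)

/-- Universal property of the truncated path algebra: the arrows `a : s ⟶ t` may be sent to
arbitrary elements of `e_s J e_t`, where `J` is the arrow ideal. -/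
theorem exists_substitution [Fintype V] [Finite (PathUpTo V N)]
    (hw₁ : ∀ {s t : V} (e : s ⟶ t), vertex s * w e = w e)
    (hw₂ : ∀ {s t : V} (e : s ⟶ t), w e * vertex t = w e)
    (hw : ∀ {s t : V} (e : s ⟶ t), w e ∈ fil k V N R 1) :
    ∃ φ : PathAlg k V N R →ₐ[R] PathAlg k V N R,
      (∀ i, φ (vertex i) = vertex i) ∧ ∀ {s t : V} (e : s ⟶ t), φ (single e.toPath) = w e := by
  classical
  have := Fintype.ofFinite (PathUpTo V N)
  let Φ : PathAlg k V N R →ₗ[R] PathAlg k V N R :=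
    { toFun := fun f => ∑ p : PathUpTo V N, f (ofPath k N p.path) • pathProd w p.path
      map_add' := fun f g => by simp only [add_apply, add_smul, Finset.sum_add_distrib]
      map_smul' := fun r f => by
        simp only [smul_apply, mul_smul, Finset.smul_sum, RingHom.id_apply] }
  have hΦ : ∀ f, Φ f = ∑ p : PathUpTo V N, f (ofPath k N p.path) • pathProd w p.path :=
    fun _ => rfl
  have hsingle : ∀ {a b : V} (p : Quiver.Path a b), Φ (single p) = pathProd w p := fun {a b} p => by
    by_cases h : (p.length : ℕ∞) ≤ N
    · rw [hΦ, Finset.sum_eq_single (⟨a, b, p, h⟩ : PathUpTo V N)]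
      · rw [single_apply_self p h, one_smul]
      · intro q _ hq
        rw [single_apply _ _ q.length_le, if_neg, zero_smul]
        intro heq
        apply hq
        rcases q with ⟨a', b', q, hq'⟩
        cases heq
        rfl
      · simp
    · have h1 : (single p : PathAlg k V N R) = 0 :=
        eq_zero_of_mem_fil (not_le.1 h) (single_mem_fil p)
      rw [h1, map_zero, eq_zero_of_mem_fil (not_le.1 h) (pathProd_mem_fil hw p)]
  -- compatibility with right multiplication by `g` can be checked on paths
  have hlin : ∀ g h : PathAlg k V N R, (∀ {a b : V} (p : Quiver.Path a b),
      Φ (single p * g) = Φ (single p) * h) → ∀ f, Φ (f * g) = Φ f * h := fun g h H f => by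
    rw [eq_sum_single f, Finset.sum_mul, map_sum, map_sum, Finset.sum_mul]
    refine Finset.sum_congr rfl fun p _ => ?_
    rw [smul_mul_assoc, map_smul, map_smul, H, smul_mul_assoc]
  have hvertex : ∀ i f, Φ (f * vertex i) = Φ f * vertex i := fun i => hlin _ _ fun {a b} p => by
    rw [single_mul_single_nil]
    split_ifs with h
    · subst h
      rw [hsingle, pathProd_mul_vertex hw₂]
    · rw [map_zero, hsingle, ← pathProd_mul_vertex hw₂, mul_assoc, vertex_mul_vertex, if_neg h,
        mul_zero]
  have harrow : ∀ {s t : V} (e : s ⟶ t) f, Φ (f * single e.toPath) = Φ f * w e := fun {s t} e =>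
    hlin _ _ fun {a b} p => by
      by_cases h : b = s
      · subst h
        rw [← single_cons, hsingle, hsingle, pathProd]
      · rw [← single_mul_vertex p, ← vertex_mul_single e.toPath, mul_assoc, ← mul_assoc (vertex b),
          vertex_mul_vertex, if_neg h, zero_mul, mul_zero, map_zero, hvertex, ← hw₁ e, mul_assoc,
          ← mul_assoc (vertex b), vertex_mul_vertex, if_neg h, zero_mul, mul_zero]
  have hmul : ∀ {a b : V} (q : Quiver.Path a b) f, Φ (f * single q) = Φ f * Φ (single q) := by
    intro a b q
    induction q with
    | nil =>
      intro f
      rw [hvertex, hsingle]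
      rfl
    | cons q e ih =>
      intro f
      rw [single_cons, ← mul_assoc, harrow, harrow, ih, mul_assoc]
  refine ⟨AlgHom.ofLinearMap Φ ?_ ?_, fun i => hsingle _, fun e => ?_⟩
  · rw [← sum_single_nil, map_sum]
    exact Finset.sum_congr rfl fun i _ => hsingle _
  · intro f g
    rw [eq_sum_single g, Finset.mul_sum, map_sum, map_sum, Finset.mul_sum]
    refine Finset.sum_congr rfl fun p _ => ?_
    rw [mul_smul_comm, map_smul, map_smul, hmul, mul_smul_comm]
  · change Φ (single e.toPath) = _
    rw [hsingle]
    exact hw₁ e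

/-- Conjugation by an invertible element. -/
def conjHom (v v' : PathAlg k V N R) (h : v * v' = 1) (h' : v' * v = 1) :
    PathAlg k V N R →ₐ[R] PathAlg k V N R :=
  AlgHom.ofLinearMap (LinearMap.mulRight R v' ∘ₗ LinearMap.mulLeft R v)
    (by simp [h]) fun f g => by
      simp only [LinearMap.comp_apply, LinearMap.mulLeft_apply, LinearMap.mulRight_apply]
      calc v * (f * g) * v' = v * f * 1 * g * v' := by simp only [mul_assoc, one_mul]
        _ = v * f * v' * (v * g * v') := by rw [← h']; simp only [mul_assoc]

end Substitution

/-! ### Change of the coefficient ring -/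

section MapCoeff

variable {k : Type*} [Field k] {V : Type*} [Quiver V] {N : ℕ∞} {R S : Type*} [CommRing R]
  [Algebra k R] [CommRing S] [Algebra k S] (θ : R →ₐ[k] S)

/-- Application of an algebra homomorphism to all coefficients. -/
def mapCoeff : PathAlg k V N R →+* PathAlg k V N S where
  toFun f := toConv (θ.toLinearMap ∘ₗ f.ofConv)
  map_one' := ext fun a b p h => by
    change θ ((1 : PathAlg k V N R) (ofPath k N p)) = _
    rw [one_ofPath p h, one_ofPath p h]
    split_ifs <;> simp
  map_mul' f g := WithConv.ext (LinearMap.algHom_comp_convMul_distrib θ f g)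
  map_zero' := ext fun a b p h => map_zero θ
  map_add' f g := ext fun a b p h => map_add θ _ _

theorem mapCoeff_apply (f : PathAlg k V N R) (c : PathCoalgebra k V N) :
    mapCoeff θ f c = θ (f c) := rfl

theorem mapCoeff_single {a b : V} (p : Quiver.Path a b) :
    mapCoeff θ (single p : PathAlg k V N R) = single p := by
  classical
  refine ext fun a' b' q h => ?_
  rw [mapCoeff_apply, single_apply p q h, single_apply p q h]
  split_ifs <;> simp

theorem mapCoeff_diagPart [Fintype V] (f : PathAlg k V N R) :
    mapCoeff θ (diagPart f) = diagPart (mapCoeff θ f) := by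
  simp only [diagPart, map_sum, map_mul, mapCoeff_single]

theorem mapCoeff_mem_fil {n : ℕ} {f : PathAlg k V N R} (hf : f ∈ fil k V N R n) :
    mapCoeff θ f ∈ fil k V N S n := fun a b p h => by
  rw [mapCoeff_apply, hf a b p h, map_zero]

end MapCoeff

/-! ### The generic automorphism fixing the vertices modulo the arrow ideal -/

section Generic

variable {k : Type*} [Field k] {V : Type*} [Quiver V] {N : ℕ∞}

/-- The unipotent element with diagonal part `1` and prescribed coefficients at the paths with
distinct end points. -/
def unipotentOf {R : Type*} [CommRing R] [Algebra k R] (x : CoordIndex N (fun s : V => s) → R) :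
    PathAlg k V N R :=
  open Classical in
  1 + ofFun fun a b p => if h : a ≠ b ∧ (p.length : ℕ∞) ≤ N then
    x ⟨a, b, .inr ⟨h.1⟩, ⟨p, Nat.one_le_iff_ne_zero.2 fun h0 => h.1 (p.eq_of_length_zero h0), h.2⟩⟩
    else 0

/-- The arrow `e` deformed inside `e_s J e_t`, where `J` is the arrow ideal. -/
def arrowOf [Finite (PathUpTo V N)] {R : Type*} [CommRing R] [Algebra k R]
    (x : CoordIndex N (fun s : V => s) → R) {s t : V} (e : s ⟶ t) : PathAlg k V N R :=
  have := Fintype.ofFinite (RadPath N s t)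
  single e.toPath + ∑ p : RadPath N s t, x ⟨s, t, .inl e, p⟩ • single p.1

variable {R : Type*} [CommRing R] [Algebra k R] (x : CoordIndex N (fun s : V => s) → R)

theorem unipotentOf_apply {a b : V} (h : a ≠ b) (p : RadPath N a b) :
    unipotentOf x (ofPath k N p.1) = x ⟨a, b, .inr ⟨h⟩, p⟩ := by
  classical
  rw [unipotentOf, add_apply, ofFun_apply _ _ p.2.2, one_ofPath _ p.2.2,
    if_neg (by have := p.2.1; omega), zero_add, dif_pos ⟨h, p.2.2⟩]

theorem unipotentOf_sub_one_mem_fil :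
    (unipotentOf x : PathAlg k V N R) - 1 ∈ fil k V N R 1 := by
  classical
  refine mem_fil_one.2 fun i => ?_
  rw [unipotentOf, add_sub_cancel_left, ofFun_apply _ _ (nil_length_le i), dif_neg (by simp)]

theorem diagPart_unipotentOf [Fintype V] : diagPart (unipotentOf x : PathAlg k V N R) = 1 := by
  classical
  refine ext fun a b p h => ?_
  rw [diagPart_apply]
  split_ifs with hab
  · rw [unipotentOf, add_apply, ofFun_apply _ _ h, dif_neg (fun h => h.1 hab), add_zero]
  · rw [one_ofPath p h, if_neg fun h0 => hab (p.eq_of_length_zero h0)]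

theorem mapCoeff_unipotentOf_eq_one {S : Type*} [CommRing S] [Algebra k S] (θ : R →ₐ[k] S)
    (hθ : ∀ i, θ (x i) = 0) : mapCoeff θ (unipotentOf x : PathAlg k V N R) = 1 := by
  classical
  rw [unipotentOf, map_add, map_one, add_eq_left]
  refine ext fun a b p h => ?_
  rw [mapCoeff_apply, ofFun_apply _ _ h]
  split_ifs
  · exact hθ _
  · exact map_zero θ

variable [Finite (PathUpTo V N)] {s t : V} (e : s ⟶ t)

theorem arrowOf_apply (p : RadPath N s t) : (arrowOf x e : PathAlg k V N R) (ofPath k N p.1) =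
    (single e.toPath : PathAlg k V N R) (ofPath k N p.1) + x ⟨s, t, .inl e, p⟩ := by
  classical
  rw [arrowOf, add_apply, convDual_sum_apply, Finset.sum_eq_single p]
  · rw [smul_apply, single_apply_self _ p.2.2, mul_one]
  · intro q _ hq
    rw [smul_apply, single_apply _ _ p.2.2, if_neg, mul_zero]
    intro heq
    apply hq
    simp only [Sigma.mk.injEq, heq_eq_eq, true_and] at heq
    exact Subtype.ext heq.symm
  · simp

theorem vertex_mul_arrowOf : vertex s * (arrowOf x e : PathAlg k V N R) = arrowOf x e := by
  simp only [arrowOf, mul_add, Finset.mul_sum, mul_smul_comm, vertex_mul_single]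

theorem arrowOf_mul_vertex : (arrowOf x e : PathAlg k V N R) * vertex t = arrowOf x e := by
  simp only [arrowOf, add_mul, Finset.sum_mul, smul_mul_assoc, single_mul_vertex]

theorem arrowOf_mem_fil : (arrowOf x e : PathAlg k V N R) ∈ fil k V N R 1 := by
  refine Submodule.add_mem _ (single_mem_fil e.toPath) (Submodule.sum_mem _ fun p _ =>
    Submodule.smul_mem _ _ ?_)
  exact fun a b q hq => single_apply_eq_zero (by have := p.2.1; omega)

theorem mapCoeff_arrowOf_eq_single {S : Type*} [CommRing S] [Algebra k S] (θ : R →ₐ[k] S)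
    (hθ : ∀ i, θ (x i) = 0) :
    mapCoeff θ (arrowOf x e : PathAlg k V N R) = single e.toPath := by
  rw [arrowOf, map_add, map_sum, mapCoeff_single, add_eq_left]
  refine Finset.sum_eq_zero fun p _ => ext fun a b q h => ?_
  rw [mapCoeff_apply, smul_apply, map_mul, hθ, zero_mul]
  rfl

end Generic

/-! ### The dimension of the automorphism group -/

section Dimension

variable {k : Type*} [Field k] {V : Type*} [Quiver V] {N : ℕ∞} {m : ℕ}

theorem reindex_basis_apply (e : PathUpTo V N ≃ Fin m) (j : Fin m) :
    ((basis k V N).reindex e) j = ofPath k N (e.symm j).path := by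
  rw [Module.Basis.reindex_apply, basis_eq_ofPath]

theorem coordForm_reindex (e : PathUpTo V N ≃ Fin m) (j : Fin m) {R : Type*} [CommRing R]
    [Algebra k R] :
    coordForm ((basis k V N).reindex e) R j = single (e.symm j).path := by
  classical
  refine convDual_ext ((basis k V N).reindex e) fun i => ?_
  rw [coordForm_apply, reindex_basis_apply, single_apply _ _ (e.symm i).length_le]
  refine if_congr ?_ rfl rfl
  rw [← e.symm.injective.eq_iff]
  generalize e.symm i = p
  generalize e.symm j = q
  constructor
  · rintro rfl
    rfl
  · rcases p with ⟨a, b, p, hp⟩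
    rcases q with ⟨a', b', q, hq⟩
    intro h
    cases h
    rfl

variable [Fintype V]

theorem natCard_coordIndex [Finite (PathUpTo V N)] [∀ s t : V, Finite (s ⟶ t)] (σ : V → V) :
    Nat.card (CoordIndex N σ) =
      ∑ s : V, ∑ t : V, Nat.card ((s ⟶ t) ⊕ PLift (s ≠ t)) * Nat.card (RadPath N (σ s) (σ t)) := by
  simp only [CoordIndex, Nat.card_sigma, Nat.card_prod]

/-- The dimension bound for a domain generated by the entries of an automorphism and its inverse. -/
theorem ringKrullDim_le_of_isAutMatrix (e : PathUpTo V N ≃ Fin m) [∀ s t : V, Finite (s ⟶ t)]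
    {K : Type*} [CommRing K] [IsDomain K] [Algebra k K] {M M' : Matrix (Fin m) (Fin m) K}
    (hM : IsAutMatrix ((basis k V N).reindex e) M M')
    (hgen : ∀ S : Subalgebra k K, (∀ i j, M i j ∈ S) → (∀ i j, M' i j ∈ S) → S = ⊤) :
    ringKrullDim K ≤ Nat.card (CoordIndex N (fun s : V => s)) := by
  have : Finite (PathUpTo V N) := Finite.of_equiv _ e.symm
  obtain ⟨φ, hφ⟩ := hM.exists_algEquiv
  obtain ⟨σ, x, hcard, hx⟩ := exists_coordinates φ
  have hentry : ∀ i j, M i j ∈ Algebra.adjoin k (Set.range x) := fun i j => by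
    have h1 : φ (coordForm ((basis k V N).reindex e) K j) ((basis k V N).reindex e i) = M i j := by
      rw [hφ]
      simp only [coordForm_apply]
      simp
    rw [← h1, coordForm_reindex, reindex_basis_apply]
    exact hx _ _ _ _ _ _
  have hdet : M.det * M'.det = 1 := by rw [← Matrix.det_mul, hM.mul_inv, Matrix.det_one]
  have hMS : ∀ i j, M i j ∈ Algebra.adjoin k (insert M'.det (Set.range x)) := fun i j =>
    Algebra.adjoin_mono (Set.subset_insert _ _) (hentry i j)
  refine (ringKrullDim_le_card_of_generated x (Matrix.det_mem_subalgebra _ hentry) hdet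
    (hgen _ hMS (Matrix.inverse_mem_subalgebra _ hM.mul_inv hMS
      (Algebra.subset_adjoin (Set.mem_insert _ _))))).trans ?_
  rw [natCard_coordIndex, natCard_coordIndex]
  simp only [← hcard, le_refl]

theorem ringKrullDim_autCoordRing_le (e : PathUpTo V N ≃ Fin m) [∀ s t : V, Finite (s ⟶ t)] :
    ringKrullDim (AutCoordRing ((basis k V N).reindex e)) ≤
      Nat.card (CoordIndex N (fun s : V => s)) := by
  refine ringKrullDim_le_of_forall_quotient_isPrime fun P hP => ?_
  refine ringKrullDim_le_of_isAutMatrix e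
    ((isAutMatrix_univ ((basis k V N).reindex e)).map (Ideal.Quotient.mkₐ k P)) fun S h h' => ?_
  rw [eq_top_iff, ← (AlgHom.range_eq_top _).2 (Ideal.Quotient.mkₐ_surjective k P),
    ← Algebra.map_top, ← adjoin_univMatrix ((basis k V N).reindex e), AlgHom.map_adjoin]
  refine Algebra.adjoin_le ?_
  rintro _ ⟨_, ⟨i, rfl⟩ | ⟨i, rfl⟩, rfl⟩
  · exact h i.1 i.2
  · exact h' i.1 i.2

/-- The generic automorphism identifies a principal open subset of affine space with a closed
subscheme of the automorphism group. -/
theorem le_ringKrullDim_autCoordRing (e : PathUpTo V N ≃ Fin m) [∀ s t : V, Finite (s ⟶ t)] :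
    (Nat.card (CoordIndex N (fun s : V => s)) : WithBot ℕ∞) ≤
      ringKrullDim (AutCoordRing ((basis k V N).reindex e)) := by
  classical
  have : Finite (PathUpTo V N) := Finite.of_equiv _ e.symm
  set b := (basis k V N).reindex e
  let T := CoordIndex N (fun s : V => s)
  let B := MvPolynomial T k
  let x : T → B := MvPolynomial.X
  -- the generic automorphism `ψ` over the polynomial ring `B`
  let v : PathAlg k V N B := unipotentOf x
  have hv := unipotentOf_sub_one_mem_fil (k := k) x
  obtain ⟨v', -, hvv', hv'v, -⟩ := exists_inverse hv
  obtain ⟨φ, hφ1, hφ2⟩ := exists_substitution (w := fun {_ _} a => arrowOf x a)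
    (fun a => vertex_mul_arrowOf (k := k) x a) (fun a => arrowOf_mul_vertex (k := k) x a)
    (fun a => arrowOf_mem_fil (k := k) x a)
  let ψ : PathAlg k V N B →ₐ[B] PathAlg k V N B := (conjHom v v' hvv' hv'v).comp φ
  have hψ1 : ∀ i, ψ (vertex i) = v * vertex i * v' := fun i => by
    change v * φ _ * v' = _
    rw [hφ1]
  have hψ2 : ∀ {s t : V} (a : s ⟶ t), ψ (single a.toPath) = v * arrowOf x a * v' := fun a => by
    change v * φ _ * v' = _
    rw [hφ2]
  let M : Matrix (Fin m) (Fin m) B := Matrix.of fun i j => ψ (coordForm b B j) (b i)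
  have hMc : IsCoalgMatrix b M := isCoalgMatrix_of_algHom b ψ fun i j => rfl
  -- at the origin, the generic automorphism specialises to the identity
  let c : B →ₐ[k] k := MvPolynomial.aeval (0 : T → k)
  have hcx : ∀ i, c (x i) = 0 := fun i => MvPolynomial.aeval_X _ i
  have hcv : mapCoeff c v = 1 := mapCoeff_unipotentOf_eq_one x c hcx
  have hcv' : mapCoeff c v' = 1 := by
    have := congrArg (mapCoeff c) hvv'
    rwa [map_mul, hcv, one_mul, map_one] at this
  have hcψ : ∀ {a a' : V} (p : Quiver.Path a a'), mapCoeff c (ψ (single p)) = single p := by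
    intro a a' p
    induction p with
    | nil => rw [hψ1, map_mul, map_mul, hcv, hcv', mapCoeff_single, one_mul, mul_one]
    | cons p a ih =>
      rw [single_cons, map_mul, map_mul, ih, hψ2, map_mul, map_mul, hcv, hcv',
        mapCoeff_arrowOf_eq_single x a c hcx, one_mul, mul_one, single_cons]
  let g : B := M.det
  have hg : MvPolynomial.constantCoeff g ≠ 0 := by
    have h1 : M.map c = 1 := by
      ext i j
      change c (ψ (coordForm b B j) (b i)) = _
      rw [← mapCoeff_apply, coordForm_reindex, hcψ, ← coordForm_reindex, coordForm_apply,
        Matrix.one_apply]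
    have h2 : c g = 1 := by
      have h3 := RingHom.map_det (c : B →+* k) M
      have h4 : (c : B →+* k).mapMatrix M = 1 := h1
      rw [h4, Matrix.det_one] at h3
      exact h3
    have h3 : c g = MvPolynomial.constantCoeff g := MvPolynomial.aeval_zero g
    rw [← h3, h2]
    exact one_ne_zero
  -- it becomes invertible over the localization `S`, hence is classified by a map `h` to `S`
  let S := Localization.Away g
  let θ : B →ₐ[k] S := IsScalarTower.toAlgHom k B S
  have hθg : IsUnit (M.map θ).det := by
    have h1 : (M.map θ).det = θ g := (RingHom.map_det (θ : B →+* S) M).symm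
    rw [h1]
    exact IsLocalization.Away.algebraMap_isUnit (S := S) g
  have hMinv := Matrix.mul_nonsing_inv (M.map θ) hθg
  have hMS : IsAutMatrix b (M.map θ) (M.map θ)⁻¹ :=
    ⟨hMc.map θ, hMinv, Matrix.nonsing_inv_mul _ hθg⟩
  obtain ⟨h, hh, hh'⟩ := hMS.exists_hom
  have hM1 : ∀ i j, θ (M i j) ∈ h.range := fun i j => by
    have : θ (M i j) = h (univMatrix b i j) := (congrFun (congrFun hh i) j).symm
    rw [this]
    exact ⟨_, rfl⟩
  have hM2 : ∀ i j, (M.map θ)⁻¹ i j ∈ h.range := fun i j => by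
    rw [← hh']
    exact ⟨_, rfl⟩
  have hcoeff : ∀ {a a' : V} (p : Quiver.Path a a'),
      mapCoeff θ (ψ (single p)) ∈ coeffsIn h.range := by
    intro a a' p d d' q
    by_cases hp : (p.length : ℕ∞) ≤ N
    · by_cases hq : (q.length : ℕ∞) ≤ N
      · have h1 := hM1 (e ⟨d, d', q, hq⟩) (e ⟨a, a', p, hp⟩)
        change θ (ψ (coordForm b B _) (b _)) ∈ _ at h1
        rw [coordForm_reindex, reindex_basis_apply, e.symm_apply_apply, e.symm_apply_apply] at h1
        exact h1
      · rw [ofPath_eq_zero hq, map_zero]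
        exact zero_mem _
    · rw [eq_zero_of_mem_fil (not_le.1 hp) (single_mem_fil p), map_zero, map_zero]
      exact zero_mem _
  -- the generic coordinates can be recovered from the matrix of `ψ`
  have hvv'S : mapCoeff θ v * mapCoeff θ v' = 1 := by rw [← map_mul, hvv', map_one]
  have hv'vS : mapCoeff θ v' * mapCoeff θ v = 1 := by rw [← map_mul, hv'v, map_one]
  have hvS : mapCoeff θ v - 1 ∈ fil k V N S 1 := by
    rw [← map_one (mapCoeff θ), ← map_sub]
    exact mapCoeff_mem_fil θ hv
  let E : V → PathAlg k V N S := fun i => mapCoeff θ v * vertex i * mapCoeff θ v'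
  have hE : ∀ i, E i = mapCoeff θ (ψ (vertex i)) := fun i => by
    rw [hψ1, map_mul, map_mul, mapCoeff_single]
  have hvmem : mapCoeff θ v ∈ coeffsIn h.range := by
    obtain ⟨v₂, -, h2, h3, h4⟩ := exists_conjugator (E := E) (σ := Equiv.refl V)
      (fun i => by
        rw [hE, ← map_mul, ← map_mul, vertex_mul_self])
      (fun i j hij => by
        rw [hE, hE, ← map_mul, ← map_mul, vertex_mul_vertex, if_neg hij, map_zero, map_zero])
      (fun i j => by
        change evalVertex k V N S j _ = _
        rw [map_mul, map_mul, mul_right_comm, ← map_mul, hvv'S, map_one, one_mul])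
    have h5 : v₂ = mapCoeff θ v := conjugator_unique (E := E) (σ := Equiv.refl V)
      Function.surjective_id hvv'S hv'vS
      (fun i => by
        change mapCoeff θ v * vertex i * mapCoeff θ v' * mapCoeff θ v = _
        rw [mul_assoc, hv'vS, mul_one]
        rfl) h3
      (by rw [← mapCoeff_diagPart, diagPart_unipotentOf, map_one]) h2
    rw [← h5]
    exact h4 _ fun i => by
      rw [hE]
      exact hcoeff _
  have hv'mem : mapCoeff θ v' ∈ coeffsIn h.range := by
    obtain ⟨g', -, h2, -, h4⟩ := exists_inverse hvS
    have : g' = mapCoeff θ v' := by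
      rw [← one_mul g', ← hv'vS, mul_assoc, h2, mul_one]
    rw [← this]
    exact h4 _ hvmem
  have hxmem : ∀ i : T, θ (x i) ∈ h.range := by
    rintro ⟨s, t, a | ⟨⟨hst⟩⟩, p⟩
    · have h1 : mapCoeff θ (arrowOf x a) =
          mapCoeff θ v' * mapCoeff θ (ψ (single a.toPath)) * mapCoeff θ v := by
        rw [hψ2, map_mul, map_mul]
        simp only [← mul_assoc, hv'vS, one_mul]
        rw [mul_assoc, hv'vS, mul_one]
      have h2 := mul_mem (mul_mem hv'mem (hcoeff a.toPath)) hvmem _ _ p.1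
      rw [← h1, mapCoeff_apply, arrowOf_apply, map_add, ← mapCoeff_apply, mapCoeff_single] at h2
      have h3 := sub_mem h2 (single_mem_coeffsIn (N := N) h.range a.toPath _ _ p.1)
      rwa [add_sub_cancel_left] at h3
    · have h2 := hvmem _ _ p.1
      rwa [mapCoeff_apply, unipotentOf_apply x hst] at h2
  have hsurj : Function.Surjective h := by
    rw [← AlgHom.range_eq_top, eq_top_iff]
    have hpoly : ∀ f : B, θ f ∈ h.range := fun f => by
      have h1 : (⊤ : Subalgebra k B) ≤ h.range.comap θ := by
        rw [← MvPolynomial.adjoin_range_X]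
        refine Algebra.adjoin_le ?_
        rintro _ ⟨i, rfl⟩
        exact hxmem i
      exact h1 Algebra.mem_top
    have hinv : (M.map θ)⁻¹.det ∈ h.range := by
      exact Matrix.det_mem_subalgebra _ hM2
    have hginv : θ g * (M.map θ)⁻¹.det = 1 := by
      have h1 : (M.map θ).det = θ g := (RingHom.map_det (θ : B →+* S) M).symm
      rw [← h1, ← Matrix.det_mul, hMinv, Matrix.det_one]
    intro y _
    obtain ⟨n, f, hf⟩ := IsLocalization.Away.surj g y
    have h1 : y = θ f * (M.map θ)⁻¹.det ^ n := by
      calc y = y * (θ g * (M.map θ)⁻¹.det) ^ n := by rw [hginv, one_pow, mul_one]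
        _ = y * algebraMap B S g ^ n * (M.map θ)⁻¹.det ^ n := by rw [mul_pow, ← mul_assoc]; rfl
        _ = _ := by rw [hf]; rfl
    rw [h1]
    exact mul_mem (hpoly f) (pow_mem hinv n)
  exact (card_le_ringKrullDim_localizationAway g hg).trans
    (ringKrullDim_le_of_surjective (h : AutCoordRing b →+* S) hsurj)

end Dimension

end PathAlg

/-- If a quiver has finitely many paths of length at most `N`, then the automorphism group of the
truncated path coalgebra is a linear algebraic group of the expected dimension. -/
theorem isLinearAlgebraicGroupOfDim_pathCoalgebra (k : Type u) [Field k] (V : Type v) [Quiver.{w} V]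
    [Fintype V] [∀ s t : V, Finite (s ⟶ t)] (N : ℕ∞) [Finite (PathUpTo V N)] :
    IsLinearAlgebraicGroupOfDim (coalgAutFunctor k (PathCoalgebra k V N))
      (∑ s : V, ∑ t : V,
        Nat.card ((s ⟶ t) ⊕ PLift (s ≠ t)) * Nat.card (PathAlg.RadPath N s t)) := by
  let e := Finite.equivFin (PathUpTo V N)
  refine CoalgAut.isLinearAlgebraicGroupOfDim_coalgAutFunctor
    ((PathCoalgebra.basis k V N).reindex e) ?_
  rw [← PathAlg.natCard_coordIndex fun s : V => s]
  exact le_antisymm (PathAlg.ringKrullDim_autCoordRing_le e)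
    (PathAlg.le_ringKrullDim_autCoordRing e)

/-! ### Finiteness of the sets of paths -/

section Finiteness

variable {V : Type*} [Quiver V] [Finite V]

/-- In an acyclic quiver, the sets of predecessors grow strictly along a path, so that the length
of a path is bounded by the number of vertices. -/
theorem QuiverAcyclic.length_lt_ncard (h : QuiverAcyclic V) {a b : V} (p : Quiver.Path a b) :
    p.length < {c : V | Nonempty (Quiver.Path c b)}.ncard := by
  induction p with
  | nil =>
    rw [Quiver.Path.length_nil, Set.ncard_pos (Set.toFinite _)]
    exact ⟨a, ⟨.nil⟩⟩
  | @cons b c p e ih =>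
    refine Nat.lt_of_le_of_lt ih (Set.ncard_lt_ncard ⟨?_, ?_⟩ (Set.toFinite _))
    · rintro d ⟨q⟩
      exact ⟨q.cons e⟩
    · intro hsub
      obtain ⟨q⟩ : Nonempty (Quiver.Path c b) := hsub ⟨.nil⟩
      simpa using h c (q.cons e)

variable [∀ s t : V, Finite (s ⟶ t)]

theorem finite_paths_length_le (n : ℕ) (s t : V) :
    {p : Quiver.Path s t | p.length ≤ n}.Finite := by
  induction n generalizing t with
  | zero =>
    refine Set.Subsingleton.finite fun p hp q hq => ?_
    obtain rfl := p.eq_of_length_zero (Nat.le_zero.1 hp)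
    rw [p.eq_nil_of_length_zero (Nat.le_zero.1 hp), q.eq_nil_of_length_zero (Nat.le_zero.1 hq)]
  | succ n ih =>
    refine ((ih t).union (Set.finite_iUnion fun b : V => Set.finite_iUnion fun e : b ⟶ t =>
      (ih b).image fun p => p.cons e)).subset ?_
    intro p hp
    cases p with
    | nil => exact .inl (Nat.zero_le n)
    | cons p e =>
      exact .inr (Set.mem_iUnion.2 ⟨_, Set.mem_iUnion.2 ⟨e, p, Nat.le_of_succ_le_succ hp, rfl⟩⟩)

instance finite_pathUpTo_natCast (n : ℕ) : Finite (PathUpTo V (n : ℕ∞)) := by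
  have := fun s t : V => (finite_paths_length_le n s t).to_subtype
  refine Finite.of_injective (β := Σ s t : V, {p : Quiver.Path s t | p.length ≤ n})
    (fun p => ⟨p.src, p.tgt, p.path, by exact_mod_cast p.length_le⟩) ?_
  rintro ⟨a, b, p, hp⟩ ⟨a', b', q, hq⟩ h
  cases h
  rfl

theorem QuiverAcyclic.finite_pathUpTo_top (h : QuiverAcyclic V) : Finite (PathUpTo V ⊤) := by
  have hle : ∀ {a b : V} (p : Quiver.Path a b), (p.length : ℕ∞) ≤ (Nat.card V : ℕ) := fun p => by
    exact_mod_cast (h.length_lt_ncard p).le.trans (Set.ncard_le_card _)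
  refine Finite.of_injective (β := PathUpTo V (Nat.card V : ℕ))
    (fun p => ⟨p.src, p.tgt, p.path, hle p.path⟩) ?_
  rintro ⟨a, b, p, hp⟩ ⟨a', b', q, hq⟩ h
  cases h
  rfl

end Finiteness

end

theorem proposition3p5 (k : Type u) [Field k] (V : Type v) [Quiver.{w} V]
    [Fintype V] [∀ s t : V, Finite (s ⟶ t)] :
    (∀ n : ℕ, 1 ≤ n →
      IsLinearAlgebraicGroupOfDim (coalgAutFunctor k (PathCoalgebra k V n))
        (∑ s : V, ∑ t : V,
          Nat.card (AugmentedQuiver.of s ⟶ AugmentedQuiver.of t) *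
            Nat.card (NontrivialPathLE n s t))) ∧
    (QuiverAcyclic V →
      IsLinearAlgebraicGroupOfDim (coalgAutFunctor k (PathCoalgebra k V ⊤))
        (∑ s : V, ∑ t : V, (Nat.card (s ⟶ t) + 1) * Nat.card (NontrivialPath s t))) := by
  constructor
  · intro n _
    have hcard : ∀ s t : V, Nat.card (NontrivialPathLE n s t) =
        Nat.card (PathAlg.RadPath (n : ℕ∞) s t) := fun s t => by
      simp only [NontrivialPathLE, PathAlg.RadPath, Nat.cast_le]
    simp only [hcard]
    exact isLinearAlgebraicGroupOfDim_pathCoalgebra k V n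
  · intro h
    have := h.finite_pathUpTo_top
    have hcard : ∀ s t : V, (Nat.card (s ⟶ t) + 1) * Nat.card (NontrivialPath s t) =
        Nat.card ((s ⟶ t) ⊕ PLift (s ≠ t)) * Nat.card (PathAlg.RadPath ⊤ s t) := fun s t => by
      have h1 : Nat.card (NontrivialPath s t) = Nat.card (PathAlg.RadPath ⊤ s t) := by
        simp only [NontrivialPath, PathAlg.RadPath, le_top, and_true]
      rw [h1]
      by_cases hst : s = t
      · -- both sides vanish: the only closed paths are the trivial ones
        subst hst
        have : IsEmpty (PathAlg.RadPath ⊤ s s) := ⟨fun p => by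
          have h2 := p.2.1
          rw [h s p.1] at h2
          exact absurd h2 (by norm_num)⟩
        simp
      · have : Unique (PLift (s ≠ t)) := ⟨⟨⟨hst⟩⟩, fun _ => rfl⟩
        rw [Nat.card_sum, Nat.card_unique (α := PLift (s ≠ t))]
    simp only [hcard]
    exact isLinearAlgebraicGroupOfDim_pathCoalgebra k V ⊤
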